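/- Let $N$ be a lattice of rank $n$ (we fix $N=\mathbb Z^n$), $M=N^*$, $N_{\mathbb R}=N\otimes\mathbb R$, $M_{\mathbb R}=M\otimes\mathbb R$. A *simplicial multi-fan* $\Delta=(\Sigma,C,w)$ in $N$ consists of a finite simplicial complex $\Sigma$ (containing $\emptyset$; $\Sigma^{(k)}$ denotes the set of simplices with $k$ vertices) in which every simplex lies in a member of $\Sigma^{(n)}$, a map $C$ assigning to each $J\in\Sigma^{(k)}$ a $k$-dimensional strongly convex rational polyhedral cone $C(J)\subset N_{\mathbb R}$ such that for every $I\in\Sigma$ the map $J\mapsto C(J)$ is an isomorphism of ordered sets from $\{J\mid J\subset I\}$ onto the set of faces of $C(I)$, and a function $w:\Sigma^{(n)}\to\mathbb Z$. For $K\in\Sigma$ let $N_K$ be the smallest primitive sublattice of $N$ containing $N\cap C(K)$. For $v\in (N/N_K)\otimes\mathbb R$ put $d_v=\sum w(I)$, the sum over the $I\in\Sigma^{(n)}$ with $I\supset K$ such that $v$ lies in the image of $C(I)$. $\Delta$ is *complete* if for every $K\in\Sigma$ the integer $d_v$ is the same for all $v\in (N/N_K)\otimes\mathbb R$ lying on no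 linear span of the image of a cone $C(J)$ with $J\in\Sigma$, $J\supset K$, $|J|<n$. Let $\Delta$ be a complete simplicial multi-fan and $\mathcal V=\{v_i\}_{i\in\Sigma^{(1)}}$ a choice of vectors $0\ne v_i\in N\cap C(i)$ (not necessarily primitive). For $K\in\Sigma$ let $H_{K,\mathcal V}=N_K/\langle v_i\mid i\in K\rangle_{\mathbb Z}$, and for $I\in\Sigma^{(n)}$ let $\{u_i^I\}_{i\in I}\subset M_{\mathbb R}$ be the basis dual to $\{v_i\}_{i\in I}$. Let $H_T^*(\Delta,\mathcal V)_{\mathbb R}$ be the Stanley–Reisner ring $\mathbb R[x_i\mid i\in\Sigma^{(1)}]/(\prod_{i\in J}x_i\mid J\notin\Sigma)$ and $H_T^*(pt)_{\mathbb R}=S^*(M_{\mathbb R})$. For $I\in\Sigma^{(n)}$ let $\iota_I^*:H_T^*(\Delta,\mathcal V)_{\mathbb R}\to H_T^*(pt)_{\mathbb R}$ be the algebra map with $x_i\mapsto u_i^I$ for $i\in I$ and $x_i\mapsto 0$ for $i\notin I$. Put $$\pi_*(y)=\sum_{I\in\Sigma^{(n)}}\frac{w(I)\,\iota_I^*(y)}{|H_{I,\mathcal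 V}|\prod_{i\in I}u_i^I},$$ and let $p_*(y)\in\mathbb R$ be the degree $0$ component of $\pi_*(y)$ if $\pi_*(y)\in H_T^*(pt)_{\mathbb R}$; on formal power series $p_*$ is applied termwise, so that $p_*(e^{\xi}y)=\sum_{m\ge0}p_*\big(\tfrac{\xi^m}{m!}y\big)$. Let $\xi=\sum_{i\in\Sigma^{(1)}}d_ix_i$ with $d_i\in\mathbb R$, and let $K\in\Sigma^{(k)}$, $0\le k\le n$, $x_K=\prod_{i\in K}x_i$. Let $A_K^*=\{u\in M_{\mathbb R}\mid\langle u,v_i\rangle=d_i\ (i\in K)\}$, with the translation invariant measure $dV_K^*$ normalized by the lattice $M_K=\{u\in M\mid \langle u,N_K\rangle=0\}$ of its direction space (covolume $1$). Take $v\in N_{\mathbb R}$ with $\langle u_i^I,v\rangle\neq0$ for all $I\in\Sigma^{(n)}$ with $I\supset K$ and all $i\in I\setminus K$. For such $I$ let $\phi_I$ be the characteristic function of the cone in $A_K^*$ with apex $u_I=\sum_{i\in I}d_iu_i^I$ spanned by the vectors $(u_i^I)^+=\pm u_i^I$, $i\in I\setminus K$, with the sign chosen such that $\langle (u_i^I)^+,v\rangle>0$,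 let $(-1)^I=(-1)^{\#\{i\in I\setminus K\,\mid\,\langle u_i^I,v\rangle>0\}}$, and put $$\mathrm{DH}_{P(\xi)_K}=\sum_{I\in\Sigma^{(n)},\,I\supset K}(-1)^Iw(I)\phi_I,\qquad \operatorname{vol}P(\xi)_K=\int_{A_K^*}\mathrm{DH}_{P(\xi)_K}\,dV_K^*.$$ Then, for every such $v$, $\mathrm{DH}_{P(\xi)_K}$ is integrable, $H_{K,\mathcal V}$ is finite, $\pi_*\big(\tfrac{\xi^m}{m!}x_K\big)\in H_T^*(pt)_{\mathbb R}$ for all $m\ge0$, and $$\frac1{|H_{K,\mathcal V}|}\operatorname{vol}P(\xi)_K=p_*(e^{\xi}x_K).$$ -/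

import Mathlib

/-!
Simplicial multi-fans and multi-polytopes.

The lattice `N` of rank `n` is `ℤⁿ = Fin n → ℤ`, the space `N_ℝ` is `Fin n → ℝ`, and the dual
lattice `M` and the space `M_ℝ` are written `Fin n → ℤ` and `Fin n → ℝ` again, the pairing
`⟨u, v⟩` being the dot product `u ⬝ᵥ v`.
-/

open scoped Matrix

noncomputable section

namespace MultiFan

/-- The embedding of the lattice `ℤⁿ` in `ℝⁿ`. -/
def toReal {n : ℕ} (x : Fin n → ℤ) : Fin n → ℝ := fun a => (x a : ℝ)

/-- A simplicial multi-fan `Δ = (Σ, C, w)` in the lattice `N = ℤⁿ`. The vertex set `Σ⁽¹⁾` of the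
(finite, augmented) simplicial complex `Σ` is `ι`; the set `Σ⁽ᵏ⁾` consists of the simplices with
`k` vertices. The values of `cone` off `Σ`, and of `w` off `Σ⁽ⁿ⁾`, play no role. -/
structure SimplicialMultiFan (n : ℕ) (ι : Type*) where
  /-- the simplices of `Σ`, the empty one included -/
  simplices : Set (Finset ι)
  empty_mem : ∅ ∈ simplices
  singleton_mem : ∀ i : ι, {i} ∈ simplices
  down_closed : ∀ I ∈ simplices, ∀ J ⊆ I, J ∈ simplices
  /-- every simplex lies in some member of `Σ⁽ⁿ⁾` -/
  pure : ∀ J ∈ simplices, ∃ I ∈ simplices, J ⊆ I ∧ I.card = n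
  /-- the cone `C(J)` in `N_ℝ` -/
  cone : Finset ι → PointedCone ℝ (Fin n → ℝ)
  /-- `C(J)` is a rational polyhedral cone -/
  cone_rational : ∀ J ∈ simplices, ∃ S : Finset (Fin n → ℤ),
    cone J = PointedCone.hull ℝ (toReal '' (S : Set (Fin n → ℤ)))
  /-- `C(J)` is strongly convex -/
  cone_salient : ∀ J ∈ simplices, ∀ x ∈ cone J, -x ∈ cone J → x = 0
  /-- `dim C(J) = k` for `J ∈ Σ⁽ᵏ⁾` -/
  cone_dim : ∀ J ∈ simplices,
    Module.finrank ℝ (Submodule.span ℝ (cone J : Set (Fin n → ℝ))) = J.card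
  /-- `C` maps the simplices contained in `I` bijectively onto the faces of `C(I)` -/
  cone_faces : ∀ I ∈ simplices, Set.BijOn cone {J | J ⊆ I} {F | F.IsFaceOf (cone I)}
  /-- that bijection is an isomorphism of ordered sets -/
  cone_le_iff : ∀ I ∈ simplices, ∀ J ⊆ I, ∀ J' ⊆ I, (cone J ≤ cone J' ↔ J ⊆ J')
  /-- the weight function on `Σ⁽ⁿ⁾` -/
  w : Finset ι → ℤ

namespace SimplicialMultiFan

variable {n : ℕ} {ι : Type*} [Fintype ι] [DecidableEq ι]

/-- The set `Σ⁽ⁿ⁾`. -/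
def Facet (Δ : SimplicialMultiFan n ι) : Type _ := {I : Finset ι // I ∈ Δ.simplices ∧ I.card = n}

instance (Δ : SimplicialMultiFan n ι) : Fintype Δ.Facet := by
  classical exact inferInstanceAs (Fintype {I : Finset ι // I ∈ Δ.simplices ∧ I.card = n})

/-! ### Completeness -/

/-- The real span of `C(K)`, which is `N_K ⊗ ℝ`. -/
def spanCone (Δ : SimplicialMultiFan n ι) (K : Finset ι) : Submodule ℝ (Fin n → ℝ) :=
  Submodule.span ℝ (Δ.cone K : Set (Fin n → ℝ))

/-- The space `N^K ⊗ ℝ = N_ℝ / (N_K ⊗ ℝ)` in which the projected multi-fan `Δ_K` lives. -/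
abbrev ProjSpace (Δ : SimplicialMultiFan n ι) (K : Finset ι) : Type :=
  (Fin n → ℝ) ⧸ Δ.spanCone K

/-- The cone `C_K(J)`: the image of `C(J)` in `N^K ⊗ ℝ`. -/
def projCone (Δ : SimplicialMultiFan n ι) (K J : Finset ι) : Set (Δ.ProjSpace K) :=
  (Δ.spanCone K).mkQ '' (Δ.cone J : Set (Fin n → ℝ))

/-- A vector of `N^K ⊗ ℝ` which lies on no linear subspace spanned by a cone of `Δ_K` of
dimension less than `n - |K|`. -/
def IsGenericProj (Δ : SimplicialMultiFan n ι) (K : Finset ι) (v : Δ.ProjSpace K) : Prop :=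
  ∀ J ∈ Δ.simplices, K ⊆ J → J.card < n → v ∉ Submodule.span ℝ (Δ.projCone K J)

open Classical in
/-- `d_v` for the projected multi-fan `Δ_K`: the sum of `w(I)` over those `I ∈ Σ⁽ⁿ⁾` containing `K`
with `v ∈ C_K(I)`. -/
def projDegree (Δ : SimplicialMultiFan n ι) (K : Finset ι) (v : Δ.ProjSpace K) : ℤ :=
  ∑ I : Δ.Facet, if K ⊆ I.1 ∧ v ∈ Δ.projCone K I.1 then Δ.w I.1 else 0

/-- The projected multi-fan `Δ_K` is pre-complete. -/
def IsPreComplete (Δ : SimplicialMultiFan n ι) (K : Finset ι) : Prop :=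
  ∀ v v' : Δ.ProjSpace K, Δ.IsGenericProj K v → Δ.IsGenericProj K v' →
    Δ.projDegree K v = Δ.projDegree K v'

/-- The multi-fan `Δ` is complete: all the projected multi-fans `Δ_K` are pre-complete. -/
def IsComplete (Δ : SimplicialMultiFan n ι) : Prop :=
  ∀ K ∈ Δ.simplices, Δ.IsPreComplete K

/-- A set `𝒱 = {v_i}` of prescribed edge vectors: `0 ≠ v_i ∈ N ∩ C(i)`, not necessarily primitive. -/
structure EdgeVectors (Δ : SimplicialMultiFan n ι) where
  v : ι → Fin n → ℤ
  ne_zero : ∀ i, v i ≠ 0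
  mem_cone : ∀ i, toReal (v i) ∈ Δ.cone {i}

/-! ### The groups `H_{K,𝒱}` -/

/-- `N_K`: the minimal primitive (i.e. saturated) sublattice of `N` containing `N ∩ C(K)`. -/
def latticeN (Δ : SimplicialMultiFan n ι) (K : Finset ι) : Submodule ℤ (Fin n → ℤ) :=
  sInf {L | (∀ (m : ℤ) (x : Fin n → ℤ), m ≠ 0 → m • x ∈ L → x ∈ L) ∧
    ∀ x : Fin n → ℤ, toReal x ∈ Δ.cone K → x ∈ L}

namespace EdgeVectors

variable {Δ : SimplicialMultiFan n ι}

/-- `N_{K,𝒱}`: the sublattice generated by the `v_i`, `i ∈ K`. -/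
def latticeNV (V : Δ.EdgeVectors) (K : Finset ι) : Submodule ℤ (Fin n → ℤ) :=
  Submodule.span ℤ (V.v '' (K : Set ι))

/-- The group `H_{K,𝒱} = N_K / N_{K,𝒱}`. -/
abbrev H (V : Δ.EdgeVectors) (K : Finset ι) : Type :=
  Δ.latticeN K ⧸ (V.latticeNV K).comap (Δ.latticeN K).subtype

open Classical in
/-- The vectors `u_i^I ∈ M_ℝ`, `i ∈ I`, dual to the `v_j`, `j ∈ I`, for `I ∈ Σ⁽ⁿ⁾`: the vector
`u_i^I` is the unique solution `u` of `⟨u, v_j⟩ = δ_{ij}`, `j ∈ I`. -/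
def dualVec (V : Δ.EdgeVectors) (I : Finset ι) (i : ι) : Fin n → ℝ :=
  if h : ∃ u : Fin n → ℝ, ∀ j ∈ I, u ⬝ᵥ toReal (V.v j) = if i = j then 1 else 0
  then h.choose else 0

end EdgeVectors

/-! ### Equivariant cohomology with real coefficients and the push-forward -/

/-- The ideal of non-faces of `Σ`. -/
def nonfaceIdeal (Δ : SimplicialMultiFan n ι) : Ideal (MvPolynomial ι ℝ) :=
  Ideal.span ((fun K : Finset ι => ∏ i ∈ K, MvPolynomial.X i) '' {K | K ∉ Δ.simplices})

/-- `H_T^*(Δ)_ℝ`: the Stanley–Reisner ring of `Σ` with real coefficients. -/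
abbrev Cohomology (Δ : SimplicialMultiFan n ι) : Type _ := MvPolynomial ι ℝ ⧸ Δ.nonfaceIdeal

/-- The generator `x_i` of `H_T^*(Δ)_ℝ`. -/
def x (Δ : SimplicialMultiFan n ι) (i : ι) : Δ.Cohomology :=
  Ideal.Quotient.mk Δ.nonfaceIdeal (MvPolynomial.X i)

/-- The class `ξ = ∑ d_i x_i`. -/
def xi (Δ : SimplicialMultiFan n ι) (d : ι → ℝ) : Δ.Cohomology := ∑ i, d i • Δ.x i

/-- The class `x_K = ∏_{i ∈ K} x_i`. -/
def xProd (Δ : SimplicialMultiFan n ι) (K : Finset ι) : Δ.Cohomology := ∏ i ∈ K, Δ.x i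

end SimplicialMultiFan

/-- `H_T^*(pt)_ℝ`: the symmetric algebra of `M_ℝ`, i.e. the polynomials in `n` variables. -/
abbrev PtCohomology (n : ℕ) : Type := MvPolynomial (Fin n) ℝ

/-- The element of `H_T^2(pt)_ℝ = M_ℝ` given by the vector `u`. -/
def linForm {n : ℕ} (u : Fin n → ℝ) : PtCohomology n := ∑ a, u a • MvPolynomial.X a

namespace SimplicialMultiFan.EdgeVectors

variable {n : ℕ} {ι : Type*} [Fintype ι] [DecidableEq ι] {Δ : SimplicialMultiFan n ι}

/-- The map `ι_I^*` on polynomials: `x_i ↦ u_i^I` for `i ∈ I` and `x_i ↦ 0` for `i ∉ I`. -/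
def restrictPoly (V : Δ.EdgeVectors) (I : Finset ι) : MvPolynomial ι ℝ →ₐ[ℝ] PtCohomology n :=
  MvPolynomial.aeval fun i => if i ∈ I then linForm (V.dualVec I i) else 0

lemma restrictPoly_eq_zero (V : Δ.EdgeVectors) (I : Δ.Facet) (f : MvPolynomial ι ℝ)
    (hf : f ∈ Δ.nonfaceIdeal) : V.restrictPoly I.1 f = 0 := by
  have h : Δ.nonfaceIdeal ≤ RingHom.ker (V.restrictPoly I.1) := by
    refine Ideal.span_le.2 ?_
    rintro _ ⟨K, hK, rfl⟩
    obtain ⟨i, hiK, hiI⟩ : ∃ i ∈ K, i ∉ I.1 := by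
      by_contra! h
      exact hK (Δ.down_closed I.1 I.2.1 K h)
    simp only [SetLike.mem_coe, RingHom.mem_ker, map_prod]
    exact Finset.prod_eq_zero hiK (by simp [restrictPoly, hiI])
  exact h hf

/-- The restriction homomorphism `ι_I^* : H_T^*(Δ)_ℝ → H_T^*(pt)_ℝ` for `I ∈ Σ⁽ⁿ⁾`. -/
def restrict (V : Δ.EdgeVectors) (I : Δ.Facet) : Δ.Cohomology →ₐ[ℝ] PtCohomology n :=
  Ideal.Quotient.liftₐ Δ.nonfaceIdeal (V.restrictPoly I.1) (V.restrictPoly_eq_zero I)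

/-- The push-forward `π_*(y) = ∑_{I ∈ Σ⁽ⁿ⁾} w(I) ι_I^*(y) / (|H_{I,𝒱}| ∏_{i ∈ I} u_i^I)`, with values
in the fraction field of `H_T^*(pt)_ℝ`. -/
def pushforward (V : Δ.EdgeVectors) (y : Δ.Cohomology) : FractionRing (PtCohomology n) :=
  ∑ I : Δ.Facet,
    algebraMap (PtCohomology n) (FractionRing (PtCohomology n))
        (MvPolynomial.C (Δ.w I.1 : ℝ) * V.restrict I y) /
      algebraMap (PtCohomology n) (FractionRing (PtCohomology n))
        (MvPolynomial.C (Nat.card (V.H I.1) : ℝ) * ∏ i ∈ I.1, linForm (V.dualVec I.1 i))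

/-- `π_*(y)` lies in `H_T^*(pt)_ℝ`. -/
def PushforwardInPt (V : Δ.EdgeVectors) (y : Δ.Cohomology) : Prop :=
  ∃ f : PtCohomology n, algebraMap _ (FractionRing (PtCohomology n)) f = V.pushforward y

open Classical in
/-- `p_*(y)`: the component of `π_*(y) ∈ H_T^*(pt)_ℝ` in `H_T^0(pt)_ℝ = ℝ` (and `0` by convention
where `π_*(y)` is not in `H_T^*(pt)_ℝ`). -/
def pStar (V : Δ.EdgeVectors) (y : Δ.Cohomology) : ℝ :=
  if h : V.PushforwardInPt y then MvPolynomial.constantCoeff h.choose else 0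

/-! ### Multi-polytopes, Duistermaat–Heckman functions and volumes -/

/-- The affine subspace `A_K^*` of `M_ℝ`: `⟨u, v_i⟩ = d_i` for `i ∈ K`. -/
def affineA (V : Δ.EdgeVectors) (d : ι → ℝ) (K : Finset ι) : Set (Fin n → ℝ) :=
  {u | ∀ i ∈ K, u ⬝ᵥ toReal (V.v i) = d i}

/-- The vector `v` (or rather its image in `N^K ⊗ ℝ`) is generic for `P(ξ)_K`: `⟨u_i^I, v⟩ ≠ 0`
for `I ∈ Σ⁽ⁿ⁾` containing `K` and `i ∈ I \ K`. -/
def IsGeneric (V : Δ.EdgeVectors) (K : Finset ι) (v : Fin n → ℝ) : Prop :=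
  ∀ I : Δ.Facet, K ⊆ I.1 → ∀ i ∈ I.1 \ K, V.dualVec I.1 i ⬝ᵥ v ≠ 0

/-- The vertex `u_I = ι_I^*(ξ) = ∑_{i ∈ I} d_i u_i^I`, the point with `⟨u_I, v_i⟩ = d_i`, `i ∈ I`. -/
def vertex (V : Δ.EdgeVectors) (d : ι → ℝ) (I : Finset ι) : Fin n → ℝ :=
  ∑ i ∈ I, d i • V.dualVec I i

open Classical in
/-- `(u_i^I)⁺`, which is `± u_i^I` with the sign such that it is positive on `v`. -/
def dualVecPos (V : Δ.EdgeVectors) (v : Fin n → ℝ) (I : Finset ι) (i : ι) : Fin n → ℝ :=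
  if 0 < V.dualVec I i ⬝ᵥ v then V.dualVec I i else -V.dualVec I i

/-- The cone `C_K^*(I)⁺` with apex `u_I` spanned by the `(u_i^I)⁺`, `i ∈ I \ K`. -/
def dualCone (V : Δ.EdgeVectors) (d : ι → ℝ) (v : Fin n → ℝ) (K I : Finset ι) :
    Set (Fin n → ℝ) :=
  {u | ∃ c : ι → ℝ, (∀ i, 0 ≤ c i) ∧ u = V.vertex d I + ∑ i ∈ I \ K, c i • V.dualVecPos v I i}

open Classical in
/-- The sign `(-1)^I`: minus one to the number of `j ∈ I \ K` with `⟨u_j^I, v⟩ > 0`. -/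
def sign (V : Δ.EdgeVectors) (v : Fin n → ℝ) (K I : Finset ι) : ℤ :=
  (-1) ^ ((I \ K).filter fun j => 0 < V.dualVec I j ⬝ᵥ v).card

open Classical in
/-- The Duistermaat–Heckman function of the face `P(ξ)_K`, `ξ = ∑ d_i x_i`, formed with the generic
vector `v`: `∑_{I ∈ Σ⁽ⁿ⁾, I ⊇ K} (-1)^I w(I) φ_I` with `φ_I` the characteristic function of
`C_K^*(I)⁺`. (It matters on `A_K^*` only.) -/
def DH (V : Δ.EdgeVectors) (d : ι → ℝ) (v : Fin n → ℝ) (K : Finset ι) (u : Fin n → ℝ) : ℝ :=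
  ∑ I : Δ.Facet, if K ⊆ I.1 ∧ u ∈ V.dualCone d v K I.1
    then (V.sign v K I.1 : ℝ) * (Δ.w I.1 : ℝ) else 0

end SimplicialMultiFan.EdgeVectors

namespace SimplicialMultiFan

variable {n : ℕ} {ι : Type*} [Fintype ι] [DecidableEq ι]

/-- The lattice `M_K`: the annihilator of `N_K` in `M`. -/
def latticeM (Δ : SimplicialMultiFan n ι) (K : Finset ι) : Submodule ℤ (Fin n → ℤ) where
  carrier := {m | ∀ y ∈ Δ.latticeN K, m ⬝ᵥ y = 0}
  add_mem' := fun {a b} ha hb y hy => by rw [add_dotProduct, ha y hy, hb y hy, add_zero]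
  zero_mem' := fun y _ => zero_dotProduct y
  smul_mem' := fun c a ha y hy => by rw [smul_dotProduct, ha y hy, smul_zero]

end SimplicialMultiFan

namespace SimplicialMultiFan.EdgeVectors

variable {n : ℕ} {ι : Type*} [Fintype ι] [DecidableEq ι] {Δ : SimplicialMultiFan n ι}

/-- The parametrization `t ↦ p + ∑_a t_a b_a` of `A_K^*`, with `p` a point of `A_K^*` and `b` a
`ℤ`-basis of the lattice `M_K`. -/
def chart (V : Δ.EdgeVectors) (d : ι → ℝ) (K : Finset ι)
    (t : Fin (Module.finrank ℤ (Δ.latticeM K)) → ℝ) : Fin n → ℝ :=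
  Classical.epsilon (· ∈ V.affineA d K) +
    ∑ a, t a • toReal (Module.finBasis ℤ (Δ.latticeM K) a : Fin n → ℤ)

/-- The volume element `dV_K^*` on `A_K^*`, as a measure on `M_ℝ` concentrated on `A_K^*`: the
translation invariant measure for which the fundamental parallelotopes of the lattice `M_K`
parallel to `A_K^*` (of which `M ∩ A_K^*` is a translate if it is not empty) have volume `1`. -/
def volumeElement (V : Δ.EdgeVectors) (d : ι → ℝ) (K : Finset ι) :
    MeasureTheory.Measure (Fin n → ℝ) :=
  MeasureTheory.Measure.map (V.chart d K) MeasureTheory.volume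

/-- `vol P(ξ)_K = ∫_{A_K^*} DH dV_K^*`. -/
def vol (V : Δ.EdgeVectors) (d : ι → ℝ) (v : Fin n → ℝ) (K : Finset ι) : ℝ :=
  ∫ u, V.DH d v K u ∂(V.volumeElement d K)

end SimplicialMultiFan.EdgeVectors

end MultiFan

end

/-! The proof computes the Laplace transform of `DH` on A_K^* in two ways. Let r = n - |K| be the
dimension of A_K^*. If a pairs negatively with every (u_i^I)⁺, i ∈ I \ K, then e^{s⟨u,a⟩} is
integrable over each of the cones in `DH` for s > 0. The signs (-1)^I cancel those hidden in the
(u_i^I)⁺, so that the cone at u_I contributes w(I) e^{s⟨u_I,a⟩} / (s^r δ_I ∏_{i ∈ I \ K} ⟨u_i^I,a⟩),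
with δ_I the absolute determinant of the pairings of the v_i, i ∈ I \ K, with a basis of M_K. Since
|H_I| = |H_K| δ_I (`natCard_H_facet_eq_mul`), s^r ∫ e^{s⟨u,a⟩} DH is |H_K| times the localization
sum of e^{sξ} x_K at a (`laplace_DH`).

On the other hand, completeness makes `DH` vanish off a bounded set, up to a null set
(`ae_DH_bounded`). Hence the integral is a power series in s whose coefficients are moments of `DH`,
which are polynomials in a. Comparing coefficients of s^m (`moment_formula`), |H_K| π_*(ξ^m/m! x_K)
is 0 for m < r and otherwise the homogeneous polynomial a ↦ ∫ ⟨u,a⟩^{m-r}/(m-r)! DH; the admissible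
a form a nonempty open set, which is enough to identify rational functions (`pushforward_eq`). A
constant term occurs only for m = r, and there it is the volume.

The support is bounded for the following reason. Off the hyperplanes ⟨u,v_i⟩ = d_i, DH(u) is a
constant times `chamber`, whose factors compare the signs of ⟨u,v_i⟩ - d_i and ⟨u_i^I,v⟩.
Completeness at the simplices with n - 1 vertices is a balancing condition (`wall_balance`), by
which `chamber` does not change when v crosses a wall. So, for fixed u, v may be replaced by a
generic p with ⟨u - u_I,p⟩ < 0 for all I ⊇ K; if u is far from the vertices such p exist (-u
satisfies the inequalities), and every summand vanishes at p (`chamber_eq_zero`). -/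

noncomputable section

namespace MultiFan

/-! ### Convex cones: generators and faces. -/

section ConeLemmas

variable {E : Type*} [AddCommGroup E] [Module ℝ E]

lemma mem_hull_singleton {s x : E} :
    x ∈ PointedCone.hull ℝ {s} ↔ ∃ c : ℝ, 0 ≤ c ∧ x = c • s := by
  rw [PointedCone.hull, Submodule.mem_span_singleton]
  constructor
  · rintro ⟨c, rfl⟩
    exact ⟨c.1, c.2, rfl⟩
  · rintro ⟨c, hc, rfl⟩
    exact ⟨⟨c, hc⟩, rfl⟩

lemma mem_hull_insert {s x : E} {T : Set E} :
    x ∈ PointedCone.hull ℝ (insert s T) ↔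
      ∃ c : ℝ, 0 ≤ c ∧ ∃ z ∈ PointedCone.hull ℝ T, x = c • s + z := by
  rw [PointedCone.hull, Submodule.mem_span_insert]
  constructor
  · rintro ⟨c, z, hz, rfl⟩
    exact ⟨c.1, c.2, z, hz, rfl⟩
  · rintro ⟨c, hc, z, hz, rfl⟩
    exact ⟨⟨c, hc⟩, z, hz, rfl⟩

/-- A finitely generated cone has an irredundant finite set of generators. -/
lemma exists_irredundant_generators (S : Set E) (hS : S.Finite) :
    ∃ T : Set E, PointedCone.hull ℝ T = PointedCone.hull ℝ S ∧
      ∀ s ∈ T, s ∉ PointedCone.hull ℝ (T \ {s}) := by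
  induction h : S.ncard using Nat.strong_induction_on generalizing S with
  | _ m ih =>
    by_cases hirr : ∀ s ∈ S, s ∉ PointedCone.hull ℝ (S \ {s})
    · exact ⟨S, rfl, hirr⟩
    · push Not at hirr
      obtain ⟨s, hs, hmem⟩ := hirr
      obtain ⟨T, hT, hT'⟩ := ih (S \ {s}).ncard (h ▸ Set.ncard_sdiff_singleton_lt_of_mem hs hS)
        (S \ {s}) hS.sdiff rfl
      refine ⟨T, hT.trans (le_antisymm (Submodule.span_mono Set.sdiff_subset) ?_), hT'⟩
      refine Submodule.span_le.2 fun x hx => ?_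
      by_cases hxs : x = s
      · exact hxs ▸ hmem
      · exact Submodule.subset_span ⟨hx, hxs⟩

/-- In a strongly convex cone, a generator not generated by the others spans a face. -/
lemma hull_singleton_isFaceOf {T : Set E} {s : E} (hs : s ∈ T)
    (hsal : ∀ x ∈ PointedCone.hull ℝ T, -x ∈ PointedCone.hull ℝ T → x = 0)
    (hirr : s ∉ PointedCone.hull ℝ (T \ {s})) :
    (PointedCone.hull ℝ {s}).IsFaceOf (PointedCone.hull ℝ T) := by
  have hT : T = insert s (T \ {s}) := by simp [Set.insert_eq_of_mem hs]
  have hsub : PointedCone.hull ℝ (T \ {s}) ≤ PointedCone.hull ℝ T :=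
    Submodule.span_mono Set.sdiff_subset
  have hsmul : ∀ c : ℝ, 0 ≤ c → ∀ (C : PointedCone ℝ E), ∀ z ∈ C, c • z ∈ C :=
    fun c hc C z hz => C.smul_mem hc hz
  refine ⟨Submodule.span_mono (by simpa using hs), ?_⟩
  intro x y a hx hy ha hxy
  obtain ⟨b, hb, x', hx', rfl⟩ := mem_hull_insert.1 (hT ▸ hx)
  obtain ⟨b', hb', y', hy', rfl⟩ := mem_hull_insert.1 (hT ▸ hy)
  obtain ⟨c, hc, hceq⟩ := mem_hull_singleton.1 hxy
  have hz : a • x' + y' ∈ PointedCone.hull ℝ (T \ {s}) :=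
    add_mem (hsmul a ha.le _ _ hx') hy'
  have hz' : a • x' + y' = (c - (a * b + b')) • s := by
    rw [sub_smul, ← hceq]; module
  -- The part of `a • x + y` coming from the other generators is a multiple of `s`. A positive
  -- multiple would make `s` redundant; a nonpositive one puts this part and its negative in the
  -- cone, so strong convexity kills it.
  rcases lt_or_ge (a * b + b') c with h | h
  · exfalso
    apply hirr
    have h0 : 0 < c - (a * b + b') := by linarith
    have : s = (c - (a * b + b'))⁻¹ • (a • x' + y') := by
      rw [hz', smul_smul, inv_mul_cancel₀ h0.ne', one_smul]
    exact this ▸ hsmul _ (inv_nonneg.2 h0.le) (PointedCone.hull ℝ (T \ {s})) _ hz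
  · have hs' : s ∈ PointedCone.hull ℝ T := Submodule.subset_span hs
    have h1 : a • x' + y' = 0 := by
      refine hsal _ (hsub hz) ?_
      rw [hz', ← neg_smul]
      exact hsmul _ (by linarith) _ _ hs'
    have h2 : a • x' = 0 := by
      refine hsal _ (hsub (hsmul a ha.le _ _ hx')) ?_
      rw [← eq_neg_of_add_eq_zero_right h1]
      exact hsub hy'
    have h3 : x' = 0 := (smul_eq_zero.1 h2).resolve_left ha.ne'
    rw [h3, add_zero]
    exact mem_hull_singleton.2 ⟨b, hb, rfl⟩

lemma span_hull (S : Set E) :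
    Submodule.span ℝ (PointedCone.hull ℝ S : Set E) = Submodule.span ℝ S := by
  apply le_antisymm
  · exact Submodule.span_le.2 (PointedCone.hull_le_span (R := ℝ) S)
  · exact Submodule.span_mono Submodule.subset_span

end ConeLemmas

/-! ### Edge vectors of a facet and their dual basis. -/

namespace SimplicialMultiFan.EdgeVectors

variable {n : ℕ} {ι : Type*} {Δ : SimplicialMultiFan n ι}

/-- The edge vectors as vectors of `ℝⁿ`. -/
def rv (V : Δ.EdgeVectors) (i : ι) : Fin n → ℝ := toReal (V.v i)

lemma rv_ne_zero (V : Δ.EdgeVectors) (i : ι) : V.rv i ≠ 0 := by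
  intro h
  apply V.ne_zero i
  ext a
  simpa [rv, toReal] using congrFun h a

/-- C(i) lies on the line through v_i because it is one-dimensional, and on one half of it because
it is strongly convex. -/
lemma cone_singleton (V : Δ.EdgeVectors) (i : ι) :
    Δ.cone {i} = PointedCone.hull ℝ {V.rv i} := by
  have hi : V.rv i ∈ Δ.cone {i} := V.mem_cone i
  apply le_antisymm
  · intro x hx
    have hdim := Δ.cone_dim {i} (Δ.singleton_mem i)
    rw [Finset.card_singleton] at hdim
    obtain ⟨c, hc⟩ := (finrank_eq_one_iff_of_nonzero'
      (⟨V.rv i, Submodule.subset_span hi⟩ :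
        Submodule.span ℝ (Δ.cone {i} : Set (Fin n → ℝ)))
      (by simpa [Subtype.ext_iff] using V.rv_ne_zero i)).1 hdim ⟨x, Submodule.subset_span hx⟩
    have hc' : c • V.rv i = x := congrArg Subtype.val hc
    rcases le_or_gt 0 c with h | h
    · exact mem_hull_singleton.2 ⟨c, h, hc'.symm⟩
    · have : x = 0 := by
        refine Δ.cone_salient {i} (Δ.singleton_mem i) x hx ?_
        rw [← hc', ← neg_smul]
        exact (Δ.cone {i}).smul_mem (neg_nonneg.2 h.le) hi
      rw [this]; exact zero_mem _
  · exact Submodule.span_le.2 (by simpa using hi)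

/-- Each generator in an irredundant set spans a one-dimensional face. By the bijection with faces
this is C(J) for some J ⊆ I, and the dimension forces J to be a single vertex. All later work uses
cones only through this description. -/
lemma cone_eq_hull (V : Δ.EdgeVectors) {I : Finset ι} (hI : I ∈ Δ.simplices) :
    Δ.cone I = PointedCone.hull ℝ (V.rv '' (I : Set ι)) := by
  apply le_antisymm
  · obtain ⟨S, hS⟩ := Δ.cone_rational I hI
    obtain ⟨T, hT, hirr⟩ := exists_irredundant_generators (toReal '' (S : Set (Fin n → ℤ)))
      (S.finite_toSet.image _)
    rw [← hS] at hT
    rw [← hT]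
    refine Submodule.span_le.2 fun s hs => ?_
    have hface := hull_singleton_isFaceOf hs
      (by rw [hT]; exact Δ.cone_salient I hI) (hirr s hs)
    rw [hT] at hface
    obtain ⟨J, hJI, hJ⟩ := (Δ.cone_faces I hI).surjOn hface
    have hs0 : s ≠ 0 := by
      rintro rfl
      exact hirr 0 hs (zero_mem _)
    have hJs := Δ.down_closed I hI J hJI
    have hcard := Δ.cone_dim J hJs
    rw [hJ, span_hull, finrank_span_singleton hs0] at hcard
    obtain ⟨i, rfl⟩ := Finset.card_eq_one.1 hcard.symm
    have hsi : s ∈ Δ.cone {i} := by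
      rw [hJ]; exact Submodule.subset_span rfl
    rw [V.cone_singleton i] at hsi
    refine Submodule.span_mono ?_ hsi
    rintro _ rfl
    exact ⟨i, hJI (Finset.mem_singleton_self i), rfl⟩
  · refine Submodule.span_le.2 ?_
    rintro _ ⟨i, hi, rfl⟩
    have hiI : {i} ⊆ I := by simpa using hi
    exact (Δ.cone_le_iff I hI {i} hiI I subset_rfl).2 hiI (V.mem_cone i)

lemma spanCone_eq (V : Δ.EdgeVectors) {I : Finset ι} (hI : I ∈ Δ.simplices) :
    Δ.spanCone I = Submodule.span ℝ (V.rv '' (I : Set ι)) := by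
  rw [spanCone, V.cone_eq_hull hI, span_hull]

lemma linearIndependent_rv (V : Δ.EdgeVectors) {I : Finset ι} (hI : I ∈ Δ.simplices) :
    LinearIndependent ℝ (fun i : I => V.rv i) := by
  rw [linearIndependent_iff_card_eq_finrank_span, Set.finrank]
  have h := Δ.cone_dim I hI
  rw [V.cone_eq_hull hI, span_hull] at h
  rw [Set.image_eq_range] at h
  rw [Fintype.card_coe]
  exact h.symm

/-- The edge vectors of a facet form a basis of `ℝⁿ`. -/
def facetBasis (V : Δ.EdgeVectors) (I : Δ.Facet) : Module.Basis I.1 ℝ (Fin n → ℝ) :=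
  basisOfLinearIndependentOfCardEqFinrank' (fun i : I.1 => V.rv i)
    (V.linearIndependent_rv I.2.1) (by simp [I.2.2])

lemma facetBasis_apply (V : Δ.EdgeVectors) (I : Δ.Facet) (i : I.1) :
    V.facetBasis I i = V.rv i := by
  simp [facetBasis]

variable [DecidableEq ι]

lemma dualVec_dotProduct (V : Δ.EdgeVectors) (I : Δ.Facet) {i j : ι}
    (hi : i ∈ I.1) (hj : j ∈ I.1) : V.dualVec I.1 i ⬝ᵥ V.rv j = if i = j then 1 else 0 := by
  have h : ∃ u : Fin n → ℝ, ∀ j ∈ I.1, u ⬝ᵥ toReal (V.v j) = if i = j then 1 else 0 := by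
    obtain ⟨u, hu⟩ := (dotProductEquiv ℝ (Fin n)).surjective ((V.facetBasis I).coord ⟨i, hi⟩)
    refine ⟨u, fun j hj => ?_⟩
    have h1 : u ⬝ᵥ V.rv j = (V.facetBasis I).coord ⟨i, hi⟩ (V.rv j) := by
      rw [← hu]; rfl
    have h2 : V.rv j = V.facetBasis I ⟨j, hj⟩ := (V.facetBasis_apply I ⟨j, hj⟩).symm
    change u ⬝ᵥ V.rv j = _
    rw [h1, h2, Module.Basis.coord_apply, Module.Basis.repr_self, Finsupp.single_apply]
    simp [eq_comm]
  rw [dualVec, dif_pos h]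
  exact h.choose_spec j hj

lemma sum_dualVec_smul_rv (V : Δ.EdgeVectors) (I : Δ.Facet) (p : Fin n → ℝ) :
    ∑ i ∈ I.1, (V.dualVec I.1 i ⬝ᵥ p) • V.rv i = p := by
  have h := (V.facetBasis I).sum_repr p
  have hc : ∀ i : I.1, V.dualVec I.1 i ⬝ᵥ p = (V.facetBasis I).repr p i := by
    intro i
    conv_lhs => rw [← h]
    rw [dotProduct_sum, Finset.sum_eq_single i]
    · rw [dotProduct_smul, facetBasis_apply, V.dualVec_dotProduct I i.2 i.2]; simp
    · intro j _ hj
      rw [dotProduct_smul, facetBasis_apply, V.dualVec_dotProduct I i.2 j.2, if_neg]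
      · simp
      · exact fun e => hj (Subtype.ext e.symm)
    · simp
  rw [← Finset.sum_coe_sort]
  conv_rhs => rw [← h]
  exact Finset.sum_congr rfl fun i _ => by rw [hc, facetBasis_apply]

lemma dotProduct_eq_sum (V : Δ.EdgeVectors) (I : Δ.Facet) (u p : Fin n → ℝ) :
    u ⬝ᵥ p = ∑ i ∈ I.1, (u ⬝ᵥ V.rv i) * (V.dualVec I.1 i ⬝ᵥ p) := by
  conv_lhs => rw [← V.sum_dualVec_smul_rv I p]
  rw [dotProduct_sum]
  exact Finset.sum_congr rfl fun i _ => by rw [dotProduct_smul, smul_eq_mul, mul_comm]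

lemma eq_sum_smul_dualVec (V : Δ.EdgeVectors) (I : Δ.Facet) (u : Fin n → ℝ) :
    u = ∑ i ∈ I.1, (u ⬝ᵥ V.rv i) • V.dualVec I.1 i := by
  apply (dotProductEquiv ℝ (Fin n)).injective
  apply LinearMap.ext
  intro p
  change u ⬝ᵥ p = _ ⬝ᵥ p
  rw [V.dotProduct_eq_sum I u p, sum_dotProduct]
  exact Finset.sum_congr rfl fun i _ => by rw [smul_dotProduct, smul_eq_mul]

lemma dualVec_ne_zero (V : Δ.EdgeVectors) (I : Δ.Facet) {i : ι} (hi : i ∈ I.1) :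
    V.dualVec I.1 i ≠ 0 := by
  intro h
  have := V.dualVec_dotProduct I hi hi
  simp [h] at this

lemma vertex_dotProduct (V : Δ.EdgeVectors) (d : ι → ℝ) (I : Δ.Facet) (a : Fin n → ℝ) :
    V.vertex d I.1 ⬝ᵥ a = ∑ i ∈ I.1, d i * (V.dualVec I.1 i ⬝ᵥ a) := by
  rw [vertex, sum_dotProduct]
  exact Finset.sum_congr rfl fun i _ => by rw [smul_dotProduct, smul_eq_mul]

lemma vertex_dotProduct_rv (V : Δ.EdgeVectors) (d : ι → ℝ) (I : Δ.Facet) {i : ι}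
    (hi : i ∈ I.1) : V.vertex d I.1 ⬝ᵥ V.rv i = d i := by
  rw [vertex_dotProduct, Finset.sum_eq_single i]
  · rw [V.dualVec_dotProduct I hi hi]; simp
  · intro j hj hji
    rw [V.dualVec_dotProduct I hj hi, if_neg hji, mul_zero]
  · exact fun h => absurd hi h

end SimplicialMultiFan.EdgeVectors

end MultiFan
end

/-! ### Walls and the balancing condition. -/

noncomputable section

namespace MultiFan

namespace SimplicialMultiFan.EdgeVectors

variable {n : ℕ} {ι : Type*} [DecidableEq ι] {Δ : SimplicialMultiFan n ι}

lemma dualVec_dotProduct_rv_of_mem_erase (V : Δ.EdgeVectors) (I : Δ.Facet) {i j : ι}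
    (hi : i ∈ I.1) (hj : j ∈ I.1.erase i) : V.dualVec I.1 i ⬝ᵥ V.rv j = 0 := by
  rw [V.dualVec_dotProduct I hi (Finset.mem_of_mem_erase hj),
    if_neg (Finset.ne_of_mem_erase hj).symm]

/-- The span of a wall `I \ {i}` is the kernel of `u_i^I`. -/
lemma mem_spanCone_erase (V : Δ.EdgeVectors) (I : Δ.Facet) {i : ι} (hi : i ∈ I.1)
    (p : Fin n → ℝ) : p ∈ Δ.spanCone (I.1.erase i) ↔ V.dualVec I.1 i ⬝ᵥ p = 0 := by
  rw [V.spanCone_eq (Δ.down_closed _ I.2.1 _ (Finset.erase_subset i I.1))]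
  constructor
  · intro hp
    induction hp using Submodule.span_induction with
    | mem x hx =>
      obtain ⟨j, hj, rfl⟩ := hx
      exact V.dualVec_dotProduct_rv_of_mem_erase I hi hj
    | zero => exact dotProduct_zero _
    | add x y _ _ hx hy => rw [dotProduct_add, hx, hy, add_zero]
    | smul c x _ hx => rw [dotProduct_smul, hx, smul_zero]
  · intro hp
    rw [← V.sum_dualVec_smul_rv I p, ← Finset.add_sum_erase _ _ hi, hp, zero_smul, zero_add]
    exact Submodule.sum_mem _ fun j hj =>
      Submodule.smul_mem _ _ (Submodule.subset_span ⟨j, hj, rfl⟩)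

/-- Modulo the span of the wall, space is a line with coordinate u_{i₀}^{I₀}, and of the generators
of C(I) only v_i survives. The projected cone is therefore the ray through the image of v_i. -/
lemma mem_projCone_wall (V : Δ.EdgeVectors) (I₀ I : Δ.Facet) {i₀ i : ι} (hi₀ : i₀ ∈ I₀.1)
    (hi : i ∈ I.1) (hJ : I.1.erase i = I₀.1.erase i₀) (y : Fin n → ℝ)
    (hy : V.dualVec I₀.1 i₀ ⬝ᵥ y ≠ 0) :
    (Δ.spanCone (I₀.1.erase i₀)).mkQ y ∈ Δ.projCone (I₀.1.erase i₀) I.1 ↔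
      0 < (V.dualVec I₀.1 i₀ ⬝ᵥ y) * (V.dualVec I₀.1 i₀ ⬝ᵥ V.rv i) := by
  have hcone := V.cone_eq_hull I.2.1
  constructor
  · rintro ⟨z, hz, hzy⟩
    rw [Submodule.mkQ_apply, Submodule.mkQ_apply, Submodule.Quotient.eq,
      V.mem_spanCone_erase I₀ hi₀, dotProduct_sub, sub_eq_zero] at hzy
    have key : ∃ c : ℝ, 0 ≤ c ∧
        V.dualVec I₀.1 i₀ ⬝ᵥ z = c * (V.dualVec I₀.1 i₀ ⬝ᵥ V.rv i) := by
      rw [SetLike.mem_coe, hcone] at hz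
      clear hzy
      induction hz using Submodule.span_induction with
      | mem x hx =>
        obtain ⟨j, hj, rfl⟩ := hx
        by_cases hji : j = i
        · exact ⟨1, zero_le_one, by rw [hji, one_mul]⟩
        · refine ⟨0, le_rfl, ?_⟩
          rw [zero_mul]
          exact V.dualVec_dotProduct_rv_of_mem_erase I₀ hi₀
            (hJ ▸ Finset.mem_erase.2 ⟨hji, hj⟩)
      | zero => exact ⟨0, le_rfl, by simp⟩
      | add x y _ _ hx hy =>
        obtain ⟨a, ha, hx⟩ := hx
        obtain ⟨b, hb, hy⟩ := hy
        exact ⟨a + b, add_nonneg ha hb, by rw [dotProduct_add, hx, hy, add_mul]⟩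
      | smul c x _ hx =>
        obtain ⟨a, ha, hx⟩ := hx
        refine ⟨c.1 * a, mul_nonneg c.2 ha, ?_⟩
        have : c • x = c.1 • x := rfl
        rw [this, dotProduct_smul, hx, smul_eq_mul, mul_assoc]
    obtain ⟨c, hc, hcz⟩ := key
    rw [hzy] at hcz
    have hc0 : c ≠ 0 := by
      rintro rfl
      exact hy (by rw [hcz, zero_mul])
    have hi0 : V.dualVec I₀.1 i₀ ⬝ᵥ V.rv i ≠ 0 := by
      intro h
      exact hy (by rw [hcz, h, mul_zero])
    rw [hcz, mul_assoc]
    exact mul_pos (lt_of_le_of_ne hc hc0.symm) (mul_self_pos.2 hi0)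
  · intro h
    have hi0 : V.dualVec I₀.1 i₀ ⬝ᵥ V.rv i ≠ 0 := right_ne_zero_of_mul h.ne'
    refine ⟨((V.dualVec I₀.1 i₀ ⬝ᵥ y) / (V.dualVec I₀.1 i₀ ⬝ᵥ V.rv i)) • V.rv i, ?_, ?_⟩
    · rw [SetLike.mem_coe, hcone]
      refine PointedCone.smul_mem _ ?_ (Submodule.subset_span ⟨i, hi, rfl⟩)
      exact (div_pos_iff.2 (mul_pos_iff.1 h)).le
    · rw [Submodule.mkQ_apply, Submodule.mkQ_apply, Submodule.Quotient.eq,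
        V.mem_spanCone_erase I₀ hi₀, dotProduct_sub, dotProduct_smul, smul_eq_mul,
        div_mul_cancel₀ _ hi0, sub_self]

/-- A wall has n - 1 vertices, so the only simplex to avoid is the wall itself, whose projection is
0. -/
lemma isGenericProj_wall (V : Δ.EdgeVectors) (I : Δ.Facet) {i : ι} (hi : i ∈ I.1)
    (y : Fin n → ℝ) (hy : V.dualVec I.1 i ⬝ᵥ y ≠ 0) :
    Δ.IsGenericProj (I.1.erase i) ((Δ.spanCone (I.1.erase i)).mkQ y) := by
  intro J _ hJ hcard hmem
  have hJe : J = I.1.erase i := by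
    refine (Finset.eq_of_subset_of_card_le hJ ?_).symm
    rw [Finset.card_erase_of_mem hi, I.2.2]; omega
  subst hJe
  have h0 : Submodule.span ℝ (Δ.projCone (I.1.erase i) (I.1.erase i)) = ⊥ := by
    rw [Submodule.span_eq_bot]
    rintro _ ⟨z, hz, rfl⟩
    rw [Submodule.mkQ_apply, Submodule.Quotient.mk_eq_zero]
    exact Submodule.subset_span hz
  rw [h0, Submodule.mem_bot, Submodule.mkQ_apply, Submodule.Quotient.mk_eq_zero,
    V.mem_spanCone_erase I hi] at hmem
  exact hy hmem

lemma eq_of_erase_eq (I : Δ.Facet) {J : Finset ι} {i j : ι}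
    (hj : j ∈ I.1) (hiJ : I.1.erase i = J) (hjJ : I.1.erase j = J) : j = i := by
  by_contra h
  have : j ∈ I.1.erase i := Finset.mem_erase.2 ⟨h, hj⟩
  rw [hiJ, ← hjJ] at this
  exact Finset.notMem_erase j I.1 this

variable [Fintype ι]

/-- The balancing condition at a wall of a complete multi-fan. -/
lemma wall_balance (hΔ : Δ.IsComplete) (V : Δ.EdgeVectors) (I₀ : Δ.Facet) {i₀ : ι}
    (hi₀ : i₀ ∈ I₀.1) :
    ∑ I : Δ.Facet, ∑ i ∈ I.1 with I.1.erase i = I₀.1.erase i₀,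
      (Δ.w I.1 : ℝ) * Real.sign (V.dualVec I₀.1 i₀ ⬝ᵥ V.rv i) = 0 := by
  have h1 : V.dualVec I₀.1 i₀ ⬝ᵥ V.rv i₀ = 1 := by rw [V.dualVec_dotProduct I₀ hi₀ hi₀]; simp
  have h2 : V.dualVec I₀.1 i₀ ⬝ᵥ (-V.rv i₀) = -1 := by rw [dotProduct_neg, h1]
  -- The degrees are compared at ±v_{i₀}, one point on each side of the wall. A facet through the
  -- wall contributes to the degree on one side only, so the difference of the degrees is the signed
  -- sum.
  have hpc := hΔ _ (Δ.down_closed _ I₀.2.1 _ (Finset.erase_subset i₀ I₀.1)) _ _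
    (V.isGenericProj_wall I₀ hi₀ (V.rv i₀) (by rw [h1]; norm_num))
    (V.isGenericProj_wall I₀ hi₀ (-V.rv i₀) (by rw [h2]; norm_num))
  rw [← sub_eq_zero] at hpc
  unfold projDegree at hpc
  rw [← Finset.sum_sub_distrib] at hpc
  have hpc' := congrArg (Int.cast : ℤ → ℝ) hpc
  rw [Int.cast_zero, Int.cast_sum] at hpc'
  rw [← hpc']
  refine Finset.sum_congr rfl fun I _ => ?_
  by_cases hJ : I₀.1.erase i₀ ⊆ I.1
  · obtain ⟨i, hi, hiI⟩ : ∃ i ∈ I.1, I.1.erase i = I₀.1.erase i₀ := by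
      have hne : (I.1 \ I₀.1.erase i₀).card = 1 := by
        rw [Finset.card_sdiff_of_subset hJ, Finset.card_erase_of_mem hi₀, I.2.2, I₀.2.2]
        have : 0 < I₀.1.card := Finset.card_pos.2 ⟨_, hi₀⟩
        rw [I₀.2.2] at this
        omega
      obtain ⟨i, hi⟩ := Finset.card_eq_one.1 hne
      have hi' : i ∈ I.1 \ I₀.1.erase i₀ := by rw [hi]; simp
      refine ⟨i, (Finset.mem_sdiff.1 hi').1, ?_⟩
      rw [← Finset.sdiff_singleton_eq_erase, ← hi, Finset.sdiff_sdiff_eq_self hJ]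
    rw [Finset.sum_eq_single_of_mem i (by simp [hi, hiI])]
    · rw [V.mem_projCone_wall I₀ I hi₀ hi hiI _ (by rw [h1]; norm_num),
        V.mem_projCone_wall I₀ I hi₀ hi hiI _ (by rw [h2]; norm_num), h1, h2]
      rcases lt_trichotomy (V.dualVec I₀.1 i₀ ⬝ᵥ V.rv i) 0 with h | h | h
      · rw [Real.sign_of_neg h, if_neg (by rintro ⟨_, h'⟩; linarith), if_pos ⟨hJ, by linarith⟩]
        push_cast; ring
      · rw [h, Real.sign_zero, if_neg (by rintro ⟨_, h'⟩; linarith),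
          if_neg (by rintro ⟨_, h'⟩; linarith)]
        simp
      · rw [Real.sign_of_pos h, if_pos ⟨hJ, by linarith⟩, if_neg (by rintro ⟨_, h'⟩; linarith)]
        push_cast; ring
    · intro j hj hji
      rw [Finset.mem_filter] at hj
      exact absurd (eq_of_erase_eq I hj.1 hiI hj.2) hji
  · rw [if_neg (fun h => hJ h.1), if_neg (fun h => hJ h.1), sub_zero, Int.cast_zero]
    refine Finset.sum_eq_zero fun i hi => ?_
    rw [Finset.mem_filter] at hi
    exact absurd (hi.2 ▸ Finset.erase_subset i I.1) hJ

end SimplicialMultiFan.EdgeVectors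

end MultiFan
end

/-! ### Wall crossing and vanishing of the Duistermaat–Heckman function far away. -/

noncomputable section

namespace MultiFan

open Filter Topology

lemma real_sign_mul (a b : ℝ) : Real.sign (a * b) = Real.sign a * Real.sign b := by
  rcases lt_trichotomy a 0 with ha | rfl | ha <;> rcases lt_trichotomy b 0 with hb | rfl | hb
  · rw [Real.sign_of_neg ha, Real.sign_of_neg hb, Real.sign_of_pos (mul_pos_of_neg_of_neg ha hb)]
    norm_num
  · simp
  · rw [Real.sign_of_neg ha, Real.sign_of_pos hb, Real.sign_of_neg (mul_neg_of_neg_of_pos ha hb)]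
    norm_num
  · simp
  · simp
  · simp
  · rw [Real.sign_of_pos ha, Real.sign_of_neg hb, Real.sign_of_neg (mul_neg_of_pos_of_neg ha hb)]
    norm_num
  · simp
  · rw [Real.sign_of_pos ha, Real.sign_of_pos hb, Real.sign_of_pos (mul_pos ha hb)]
    norm_num

lemma real_sign_mul_self {a : ℝ} (ha : a ≠ 0) : Real.sign a * Real.sign a = 1 := by
  rcases Real.sign_apply_eq_of_ne_zero a ha with h | h <;> rw [h] <;> norm_num

lemma eventually_sign_eq {X : Type*} [TopologicalSpace X] {f : X → ℝ} (hf : Continuous f) {p : X}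
    (hp : f p ≠ 0) : ∀ᶠ q in 𝓝 p, Real.sign (f q) = Real.sign (f p) := by
  rcases lt_or_gt_of_ne hp with h | h
  · filter_upwards [hf.continuousAt.eventually (gt_mem_nhds h)] with q hq
    rw [Real.sign_of_neg h, Real.sign_of_neg hq]
  · filter_upwards [hf.continuousAt.eventually (lt_mem_nhds h)] with q hq
    rw [Real.sign_of_pos h, Real.sign_of_pos hq]

/-- A nonempty open set of `ℝⁿ` is not covered by finitely many hyperplanes. -/
lemma exists_mem_dotProduct_ne_zero {n : ℕ} {κ : Type*} [Finite κ] (c : κ → Fin n → ℝ)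
    {O : Set (Fin n → ℝ)} (hO : IsOpen O) (hne : O.Nonempty) :
    ∃ p ∈ O, ∀ x, c x ≠ 0 → c x ⬝ᵥ p ≠ 0 := by
  have hae : ∀ᵐ p : Fin n → ℝ, ∀ x, c x ≠ 0 → c x ⬝ᵥ p ≠ 0 := by
    rw [MeasureTheory.ae_all_iff]
    intro x
    by_cases hx : c x = 0
    · simp [hx]
    -- A proper subspace is a null set, and a set of full measure is dense.
    · have h0 := MeasureTheory.Measure.addHaar_submodule
        (MeasureTheory.volume : MeasureTheory.Measure (Fin n → ℝ))
        (LinearMap.ker (dotProductEquiv ℝ (Fin n) (c x))) (by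
          rw [Ne, LinearMap.ker_eq_top]
          simpa using hx)
      filter_upwards [MeasureTheory.measure_eq_zero_iff_ae_notMem.1 h0] with p hp _
      exact hp
  exact (MeasureTheory.Measure.dense_of_ae hae).inter_open_nonempty O hO hne

namespace SimplicialMultiFan.EdgeVectors

variable {n : ℕ} {ι : Type*} [DecidableEq ι] {Δ : SimplicialMultiFan n ι}

/-- Both forms vanish on the common wall, hence are proportional; evaluation at v_i gives the
factor. -/
lemma dotProduct_eq_mul_of_wall (V : Δ.EdgeVectors) (I₀ I : Δ.Facet) {i₀ i : ι} (hi₀ : i₀ ∈ I₀.1)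
    (hi : i ∈ I.1) (hJ : I.1.erase i = I₀.1.erase i₀) (p : Fin n → ℝ) :
    V.dualVec I₀.1 i₀ ⬝ᵥ p =
      (V.dualVec I₀.1 i₀ ⬝ᵥ V.rv i) * (V.dualVec I.1 i ⬝ᵥ p) := by
  rw [V.dotProduct_eq_sum I, Finset.sum_eq_single_of_mem i hi]
  intro j hj hji
  rw [V.dualVec_dotProduct_rv_of_mem_erase I₀ hi₀ (hJ ▸ Finset.mem_erase.2 ⟨hji, hj⟩), zero_mul]

lemma dotProduct_wall_ne_zero (V : Δ.EdgeVectors) (I₀ I : Δ.Facet) {i₀ i : ι} (hi₀ : i₀ ∈ I₀.1)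
    (hi : i ∈ I.1) (hJ : I.1.erase i = I₀.1.erase i₀) :
    V.dualVec I₀.1 i₀ ⬝ᵥ V.rv i ≠ 0 := by
  intro h
  have h1 := V.dotProduct_eq_mul_of_wall I₀ I hi₀ hi hJ (V.rv i₀)
  rw [V.dualVec_dotProduct I₀ hi₀ hi₀, if_pos rfl, h, zero_mul] at h1
  exact one_ne_zero h1

/-- On the hyperplane spanned by the common wall both sides are the coordinate along v_j in the
basis of edge vectors of the wall. -/
lemma dualVec_dotProduct_eq_of_wall (V : Δ.EdgeVectors) (I₀ I : Δ.Facet) {i₀ i j : ι}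
    (hJ : I.1.erase i = I₀.1.erase i₀) {p : Fin n → ℝ}
    (hp : V.dualVec I.1 i ⬝ᵥ p = 0) (hj : j ∈ I₀.1.erase i₀) :
    V.dualVec I.1 j ⬝ᵥ p = V.dualVec I₀.1 j ⬝ᵥ p := by
  have hj0 := Finset.mem_of_mem_erase hj
  have hjI : j ∈ I.1 := Finset.mem_of_mem_erase (hJ ▸ hj)
  rw [V.dotProduct_eq_sum I (V.dualVec I₀.1 j), Finset.sum_eq_single_of_mem j hjI]
  · rw [V.dualVec_dotProduct I₀ hj0 hj0, if_pos rfl, one_mul]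
  · intro k hk hkj
    by_cases hki : k = i
    · rw [hki, hp, mul_zero]
    · have hk0 : k ∈ I₀.1 := Finset.mem_of_mem_erase (hJ ▸ Finset.mem_erase.2 ⟨hki, hk⟩)
      rw [V.dualVec_dotProduct I₀ hj0 hk0, if_neg (Ne.symm hkj), zero_mul]

lemma dualVecPos_eq (V : Δ.EdgeVectors) {v : Fin n → ℝ} {I : Finset ι} {i : ι}
    (h : V.dualVec I i ⬝ᵥ v ≠ 0) :
    V.dualVecPos v I i = Real.sign (V.dualVec I i ⬝ᵥ v) • V.dualVec I i := by
  rw [dualVecPos]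
  split_ifs with h0
  · rw [Real.sign_of_pos h0, one_smul]
  · rw [Real.sign_of_neg (lt_of_le_of_ne (not_lt.1 h0) h), neg_one_smul]

/-- The coordinate of u - u_I along u_i^I is ⟨u,v_i⟩ - d_i, and the sign of ⟨u_i^I,v⟩ turns it into
the coordinate along (u_i^I)⁺. -/
lemma mem_dualCone_iff (V : Δ.EdgeVectors) (d : ι → ℝ) {v : Fin n → ℝ} {K : Finset ι}
    (hv : V.IsGeneric K v) (I : Δ.Facet) (hI : K ⊆ I.1) (u : Fin n → ℝ) :
    u ∈ V.dualCone d v K I.1 ↔ (∀ i ∈ K, u ⬝ᵥ V.rv i = d i) ∧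
      ∀ i ∈ I.1 \ K, 0 ≤ Real.sign (V.dualVec I.1 i ⬝ᵥ v) * (u ⬝ᵥ V.rv i - d i) := by
  constructor
  · rintro ⟨c, hc, rfl⟩
    have key : ∀ j ∈ I.1, (V.vertex d I.1 + ∑ i ∈ I.1 \ K, c i • V.dualVecPos v I.1 i) ⬝ᵥ V.rv j =
        d j + if j ∈ K then 0 else c j * Real.sign (V.dualVec I.1 j ⬝ᵥ v) := by
      intro j hj
      rw [add_dotProduct, V.vertex_dotProduct_rv d I hj, sum_dotProduct]
      congr 1
      have hterm : ∀ i ∈ I.1 \ K, (c i • V.dualVecPos v I.1 i) ⬝ᵥ V.rv j =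
          if i = j then c j * Real.sign (V.dualVec I.1 j ⬝ᵥ v) else 0 := by
        intro i hi
        rw [V.dualVecPos_eq (hv I hI i hi), smul_dotProduct, smul_dotProduct,
          V.dualVec_dotProduct I (Finset.mem_sdiff.1 hi).1 hj]
        split_ifs with h
        · subst h; simp
        · simp
      rw [Finset.sum_congr rfl hterm, Finset.sum_ite_eq']
      by_cases hjK : j ∈ K <;> simp [hjK, hj]
    refine ⟨fun i hi => ?_, fun i hi => ?_⟩
    · rw [key i (hI hi), if_pos hi, add_zero]
    · rw [Finset.mem_sdiff] at hi
      rw [key i hi.1, if_neg hi.2, add_sub_cancel_left, mul_left_comm,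
        real_sign_mul_self (hv I hI i (Finset.mem_sdiff.2 hi)), mul_one]
      exact hc i
  · rintro ⟨h1, h2⟩
    refine ⟨fun i => if i ∈ I.1 \ K then
      Real.sign (V.dualVec I.1 i ⬝ᵥ v) * (u ⬝ᵥ V.rv i - d i) else 0, fun i => ?_, ?_⟩
    · dsimp only
      split_ifs with h
      · exact h2 i h
      · exact le_rfl
    · conv_lhs => rw [V.eq_sum_smul_dualVec I u]
      rw [vertex, ← Finset.sum_sdiff hI, ← Finset.sum_sdiff hI (f := fun i => d i • _)]
      have hsK : ∑ i ∈ K, (u ⬝ᵥ V.rv i) • V.dualVec I.1 i = ∑ i ∈ K, d i • V.dualVec I.1 i :=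
        Finset.sum_congr rfl fun i hi => by rw [h1 i hi]
      rw [hsK]
      have : ∀ i ∈ I.1 \ K, (u ⬝ᵥ V.rv i) • V.dualVec I.1 i = d i • V.dualVec I.1 i +
          (if i ∈ I.1 \ K then Real.sign (V.dualVec I.1 i ⬝ᵥ v) * (u ⬝ᵥ V.rv i - d i) else 0) •
            V.dualVecPos v I.1 i := by
        intro i hi
        have hs := real_sign_mul_self (hv I hI i hi)
        rw [if_pos hi, V.dualVecPos_eq (hv I hI i hi), smul_smul, ← add_smul]
        congr 1
        linear_combination -(u ⬝ᵥ V.rv i - d i) * hs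
      rw [Finset.sum_congr rfl this, Finset.sum_add_distrib]
      abel

lemma sign_eq_prod (V : Δ.EdgeVectors) {v : Fin n → ℝ} {K : Finset ι}
    (hv : V.IsGeneric K v) (I : Δ.Facet) (hI : K ⊆ I.1) :
    (V.sign v K I.1 : ℝ) = ∏ i ∈ I.1 \ K, -Real.sign (V.dualVec I.1 i ⬝ᵥ v) := by
  classical
  have : ∀ i ∈ I.1 \ K, -Real.sign (V.dualVec I.1 i ⬝ᵥ v) =
      if 0 < V.dualVec I.1 i ⬝ᵥ v then -1 else 1 := by
    intro i hi
    split_ifs with h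
    · rw [Real.sign_of_pos h]
    · rw [Real.sign_of_neg (lt_of_le_of_ne (not_lt.1 h) (hv I hI i hi)), neg_neg]
  rw [Finset.prod_congr rfl this, Finset.prod_ite, Finset.prod_const, Finset.prod_const_one,
    mul_one, sign]
  push_cast
  congr

lemma card_facet_sdiff (I : Δ.Facet) {K : Finset ι} (hI : K ⊆ I.1) :
    (I.1 \ K).card = n - K.card := by
  rw [Finset.card_sdiff_of_subset hI, I.2.2]

variable [Fintype ι]

/-- The weighted count of facets with signs, as a function of the generic vector `p`; for
`ε i = ±1` it counts the cones of the multi-fan with edges `ε i • v i` which contain `p`. -/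
def chamber (V : Δ.EdgeVectors) (K : Finset ι) (ε : ι → ℝ) (p : Fin n → ℝ) : ℝ :=
  ∑ I : Δ.Facet with K ⊆ I.1,
    (Δ.w I.1 : ℝ) * ∏ i ∈ I.1 \ K, (ε i + Real.sign (V.dualVec I.1 i ⬝ᵥ p))

/-- This is the total change of `chamber` from p to a nearby q when at most one form per facet
vanishes at p. Group the terms by the wall I \ {i}: the product over the other vertices depends only
on the wall, and what remains is a multiple of the sum in `wall_balance`. -/
lemma sum_wall_jump_eq_zero (hΔ : Δ.IsComplete) (V : Δ.EdgeVectors) (K : Finset ι) (ε : ι → ℝ)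
    (p q : Fin n → ℝ) :
    ∑ I : Δ.Facet with K ⊆ I.1, ∑ i ∈ I.1 \ K with V.dualVec I.1 i ⬝ᵥ p = 0,
      (Δ.w I.1 : ℝ) * (Real.sign (V.dualVec I.1 i ⬝ᵥ q) *
        ∏ j ∈ (I.1 \ K).erase i, (ε j + Real.sign (V.dualVec I.1 j ⬝ᵥ p))) = 0 := by
  classical
  rw [Finset.sum_sigma', ← Finset.sum_fiberwise (g := fun x : (_ : Δ.Facet) × ι => x.1.1.erase x.2)]
  refine Finset.sum_eq_zero fun J _ => ?_
  by_cases hne : ∃ x ∈ (Finset.univ.filter fun I : Δ.Facet => K ⊆ I.1).sigma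
      (fun I => (I.1 \ K).filter fun i => V.dualVec I.1 i ⬝ᵥ p = 0), x.1.1.erase x.2 = J
  · obtain ⟨⟨I₀, i₀⟩, hx, rfl⟩ := hne
    simp only [Finset.mem_sigma, Finset.mem_filter, Finset.mem_univ, true_and,
      Finset.mem_sdiff] at hx
    obtain ⟨hK₀, ⟨hi₀, hi₀K⟩, hp₀⟩ := hx
    have hKJ : K ⊆ I₀.1.erase i₀ := fun k hk =>
      Finset.mem_erase.2 ⟨fun h => hi₀K (h ▸ hk), hK₀ hk⟩
    have hbal := wall_balance hΔ V I₀ hi₀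
    rw [Finset.sum_sigma'] at hbal
    have hset : ((Finset.univ.filter fun I : Δ.Facet => K ⊆ I.1).sigma
        (fun I => (I.1 \ K).filter fun i => V.dualVec I.1 i ⬝ᵥ p = 0)).filter
          (fun x => x.1.1.erase x.2 = I₀.1.erase i₀) =
        Finset.univ.sigma (fun I : Δ.Facet =>
          I.1.filter fun i => I.1.erase i = I₀.1.erase i₀) := by
      ext ⟨I, i⟩
      simp only [Finset.mem_sigma, Finset.mem_filter, Finset.mem_univ, true_and,
        Finset.mem_sdiff]
      constructor
      · rintro ⟨⟨_, ⟨hi, _⟩, _⟩, hJ⟩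
        exact ⟨hi, hJ⟩
      · rintro ⟨hi, hJ⟩
        refine ⟨⟨fun k hk => Finset.mem_of_mem_erase (hJ ▸ hKJ hk), ⟨hi, fun hiK => ?_⟩, ?_⟩, hJ⟩
        · exact Finset.notMem_erase i I.1 (hJ ▸ hKJ hiK)
        · rw [V.dotProduct_eq_mul_of_wall I₀ I hi₀ hi hJ p] at hp₀
          exact (mul_eq_zero.1 hp₀).resolve_left (V.dotProduct_wall_ne_zero I₀ I hi₀ hi hJ)
    rw [hset]
    have hterm : ∀ x ∈ Finset.univ.sigma (fun I : Δ.Facet =>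
          I.1.filter fun i => I.1.erase i = I₀.1.erase i₀),
        (Δ.w x.1.1 : ℝ) * (Real.sign (V.dualVec x.1.1 x.2 ⬝ᵥ q) *
          ∏ j ∈ (x.1.1 \ K).erase x.2, (ε j + Real.sign (V.dualVec x.1.1 j ⬝ᵥ p))) =
        (Real.sign (V.dualVec I₀.1 i₀ ⬝ᵥ q) *
          ∏ j ∈ (I₀.1 \ K).erase i₀, (ε j + Real.sign (V.dualVec I₀.1 j ⬝ᵥ p))) *
        ((Δ.w x.1.1 : ℝ) * Real.sign (V.dualVec I₀.1 i₀ ⬝ᵥ V.rv x.2)) := by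
      rintro ⟨I, i⟩ hx
      simp only [Finset.mem_sigma, Finset.mem_filter, Finset.mem_univ, true_and] at hx
      obtain ⟨hi, hJ⟩ := hx
      have hc := V.dotProduct_wall_ne_zero I₀ I hi₀ hi hJ
      have hp : V.dualVec I.1 i ⬝ᵥ p = 0 := by
        rw [V.dotProduct_eq_mul_of_wall I₀ I hi₀ hi hJ p] at hp₀
        exact (mul_eq_zero.1 hp₀).resolve_left hc
      have hs : Real.sign (V.dualVec I.1 i ⬝ᵥ q) = Real.sign (V.dualVec I₀.1 i₀ ⬝ᵥ q) *
          Real.sign (V.dualVec I₀.1 i₀ ⬝ᵥ V.rv i) := by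
        rw [V.dotProduct_eq_mul_of_wall I₀ I hi₀ hi hJ q, real_sign_mul]
        linear_combination -Real.sign (V.dualVec I.1 i ⬝ᵥ q) * real_sign_mul_self hc
      have hprod : ∏ j ∈ (I.1 \ K).erase i, (ε j + Real.sign (V.dualVec I.1 j ⬝ᵥ p)) =
          ∏ j ∈ (I₀.1 \ K).erase i₀, (ε j + Real.sign (V.dualVec I₀.1 j ⬝ᵥ p)) := by
        have he : (I.1 \ K).erase i = (I₀.1 \ K).erase i₀ := by
          rw [← Finset.erase_sdiff_comm, ← Finset.erase_sdiff_comm, hJ]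
        rw [he]
        refine Finset.prod_congr rfl fun j hj => ?_
        rw [← Finset.erase_sdiff_comm] at hj
        rw [V.dualVec_dotProduct_eq_of_wall I₀ I hJ hp (Finset.mem_sdiff.1 hj).1]
      simp only [hs, hprod]
      ring
    rw [Finset.sum_congr rfl hterm, ← Finset.mul_sum, hbal, mul_zero]
  · refine Finset.sum_eq_zero fun x hx => ?_
    rw [Finset.mem_filter] at hx
    exact absurd ⟨x, hx.1, hx.2⟩ hne

/-- `chamber` is locally constant away from codimension two. -/
lemma chamber_eventually_eq (hΔ : Δ.IsComplete) (V : Δ.EdgeVectors) (K : Finset ι) (ε : ι → ℝ)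
    (p : Fin n → ℝ)
    (hp : ∀ I : Δ.Facet, K ⊆ I.1 → ∀ i ∈ I.1 \ K, ∀ j ∈ I.1 \ K,
      V.dualVec I.1 i ⬝ᵥ p = 0 → V.dualVec I.1 j ⬝ᵥ p = 0 → i = j) :
    ∀ᶠ q in 𝓝 p, V.chamber K ε q = V.chamber K ε p := by
  have hev : ∀ᶠ q in 𝓝 p, ∀ I : Δ.Facet, ∀ i : ι, V.dualVec I.1 i ⬝ᵥ p ≠ 0 →
      Real.sign (V.dualVec I.1 i ⬝ᵥ q) = Real.sign (V.dualVec I.1 i ⬝ᵥ p) := by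
    rw [eventually_all]
    intro I
    rw [eventually_all]
    intro i
    by_cases h : V.dualVec I.1 i ⬝ᵥ p = 0
    · simp [h]
    · filter_upwards [eventually_sign_eq (f := fun q => V.dualVec I.1 i ⬝ᵥ q)
        (by fun_prop) h] with q hq _
      exact hq
  filter_upwards [hev] with q hq
  rw [← sub_eq_zero, chamber, chamber, ← Finset.sum_sub_distrib,
    ← sum_wall_jump_eq_zero hΔ V K ε p q]
  refine Finset.sum_congr rfl fun I hI => ?_
  rw [Finset.mem_filter] at hI
  rw [← mul_sub, ← Finset.mul_sum]
  congr 1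
  by_cases hz : ∃ i ∈ I.1 \ K, V.dualVec I.1 i ⬝ᵥ p = 0
  · obtain ⟨i, hi, hi0⟩ := hz
    -- As `Real.sign 0 = 0`, only the factor at `i` changes from p to q, by exactly the sign of
    -- u_i^I at q. The value on a wall is thus already the common value of both sides.
    rw [Finset.sum_eq_single_of_mem i (Finset.mem_filter.2 ⟨hi, hi0⟩),
      ← Finset.mul_prod_erase _ _ hi, ← Finset.mul_prod_erase _ _ hi, hi0, Real.sign_zero]
    · have : ∏ j ∈ (I.1 \ K).erase i, (ε j + Real.sign (V.dualVec I.1 j ⬝ᵥ q)) =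
          ∏ j ∈ (I.1 \ K).erase i, (ε j + Real.sign (V.dualVec I.1 j ⬝ᵥ p)) := by
        refine Finset.prod_congr rfl fun j hj => ?_
        rw [hq I j fun h => Finset.ne_of_mem_erase hj
          (hp I hI.2 j (Finset.mem_of_mem_erase hj) i hi h hi0)]
      rw [this]
      ring
    · intro j hj hji
      rw [Finset.mem_filter] at hj
      exact absurd (hp I hI.2 j hj.1 i hi hj.2 hi0) hji
  · push Not at hz
    rw [Finset.filter_false_of_mem hz, Finset.sum_empty, sub_eq_zero]
    exact Finset.prod_congr rfl fun j hj => by rw [hq I j (hz j hj)]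

/-- Along the line from p to q, two forms of the same facet never vanish at the same point, so
`chamber` is locally constant on a connected line. -/
lemma chamber_eq_of_transversal (hΔ : Δ.IsComplete) (V : Δ.EdgeVectors) (K : Finset ι)
    (ε : ι → ℝ) {p q : Fin n → ℝ} (hp : V.IsGeneric K p)
    (hpq : ∀ I : Δ.Facet, K ⊆ I.1 → ∀ i ∈ I.1 \ K, ∀ j ∈ I.1 \ K, i ≠ j →
      (V.dualVec I.1 i ⬝ᵥ p) * (V.dualVec I.1 j ⬝ᵥ q) ≠
        (V.dualVec I.1 j ⬝ᵥ p) * (V.dualVec I.1 i ⬝ᵥ q)) :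
    V.chamber K ε p = V.chamber K ε q := by
  have hcont : Continuous fun t : ℝ => p + t • (q - p) := by fun_prop
  have hloc : IsLocallyConstant fun t : ℝ => V.chamber K ε (p + t • (q - p)) := by
    rw [IsLocallyConstant.iff_eventually_eq]
    intro t
    refine hcont.continuousAt.eventually (chamber_eventually_eq hΔ V K ε (p + t • (q - p)) ?_)
    intro I hI i hi j hj hi0 hj0
    by_contra hij
    simp only [dotProduct_add, dotProduct_smul, dotProduct_sub, smul_eq_mul] at hi0 hj0
    -- A common zero of both forms at time t forces t times their 2 × 2 determinant at (p, q) to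
    -- vanish; t = 0 is excluded by genericity of p.
    have h1 : t * ((V.dualVec I.1 i ⬝ᵥ p) * (V.dualVec I.1 j ⬝ᵥ q) -
        (V.dualVec I.1 j ⬝ᵥ p) * (V.dualVec I.1 i ⬝ᵥ q)) = 0 := by
      linear_combination (V.dualVec I.1 i ⬝ᵥ p) * hj0 - (V.dualVec I.1 j ⬝ᵥ p) * hi0
    rcases mul_eq_zero.1 h1 with h | h
    · rw [h, zero_mul, add_zero] at hi0
      exact hp I hI i hi hi0
    · exact hpq I hI i hi j hj hij (sub_eq_zero.1 h)
  have := hloc.apply_eq_of_preconnectedSpace 0 1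
  simpa using this

/-- `chamber` vanishes for the signs determined by a point `u` far from the vertices. -/
lemma chamber_eq_zero (hΔ : Δ.IsComplete) (V : Δ.EdgeVectors) (d : ι → ℝ) (K : Finset ι)
    {v : Fin n → ℝ} (hv : V.IsGeneric K v) {u : Fin n → ℝ}
    (huK : ∀ i ∈ K, u ⬝ᵥ V.rv i = d i)
    (hu0 : ∀ I : Δ.Facet, K ⊆ I.1 → ∀ i ∈ I.1 \ K, u ⬝ᵥ V.rv i ≠ d i)
    (hu : ∀ I : Δ.Facet, K ⊆ I.1 → V.vertex d I.1 ⬝ᵥ u < u ⬝ᵥ u) :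
    V.chamber K (fun i => Real.sign (u ⬝ᵥ V.rv i - d i)) v = 0 := by
  have hopen : IsOpen {p : Fin n → ℝ | ∀ I : Δ.Facet, K ⊆ I.1 →
      (u - V.vertex d I.1) ⬝ᵥ p < 0} := by
    simp only [Set.ofPred_forall]
    exact isOpen_iInter_of_finite fun I => isOpen_iInter_of_finite fun _ =>
      isOpen_lt (by fun_prop) continuous_const
  -- The diagonal pairs (i, i) make p generic; the pairs i ≠ j make the line from v to p
  -- transversal.
  obtain ⟨p, hpO, hp⟩ := exists_mem_dotProduct_ne_zero
    (fun x : Δ.Facet × ι × ι =>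
      if x.2.1 = x.2.2 then V.dualVec x.1.1 x.2.1 else
      (V.dualVec x.1.1 x.2.1 ⬝ᵥ v) • V.dualVec x.1.1 x.2.2 -
        (V.dualVec x.1.1 x.2.2 ⬝ᵥ v) • V.dualVec x.1.1 x.2.1) hopen
    ⟨-u, fun I hI => by
      rw [dotProduct_neg, sub_dotProduct]; linarith [hu I hI]⟩
  have hgen : V.IsGeneric K p := by
    intro I hI i hi
    have := hp (I, i, i)
    simp only [if_true] at this
    exact this (V.dualVec_ne_zero I (Finset.mem_sdiff.1 hi).1)
  rw [chamber_eq_of_transversal hΔ V K _ hv (q := p)]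
  · refine Finset.sum_eq_zero fun I hI => ?_
    rw [Finset.mem_filter] at hI
    obtain ⟨i, hi, hi0⟩ : ∃ i ∈ I.1 \ K, Real.sign (u ⬝ᵥ V.rv i - d i) +
        Real.sign (V.dualVec I.1 i ⬝ᵥ p) = 0 := by
      by_contra! hall
      have hlt := hpO I hI.2
      rw [V.dotProduct_eq_sum I] at hlt
      refine absurd hlt (not_lt.2 (Finset.sum_nonneg fun i hi => ?_))
      rw [sub_dotProduct, V.vertex_dotProduct_rv d I hi]
      by_cases hiK : i ∈ K
      · rw [huK i hiK, sub_self, zero_mul]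
      · have hi' : i ∈ I.1 \ K := Finset.mem_sdiff.2 ⟨hi, hiK⟩
        have h1 := hall i hi'
        have h2 := sub_ne_zero.2 (hu0 I hI.2 i hi')
        have h3 := hgen I hI.2 i hi'
        rcases lt_or_gt_of_ne h2 with ha | ha <;> rcases lt_or_gt_of_ne h3 with hb | hb
        · exact (mul_pos_of_neg_of_neg ha hb).le
        · rw [Real.sign_of_neg ha, Real.sign_of_pos hb] at h1; norm_num at h1
        · rw [Real.sign_of_pos ha, Real.sign_of_neg hb] at h1; norm_num at h1
        · exact (mul_pos ha hb).le
    rw [Finset.prod_eq_zero hi hi0, mul_zero]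
  · intro I hI i hi j hj hij h
    have := hp (I, i, j)
    simp only [if_neg hij] at this
    refine this ?_ ?_
    · intro h0
      have h1 := congrArg (fun x => x ⬝ᵥ V.rv j) h0
      have hiI := (Finset.mem_sdiff.1 hi).1
      have hjI := (Finset.mem_sdiff.1 hj).1
      simp only [sub_dotProduct, smul_dotProduct, V.dualVec_dotProduct I hjI hjI,
        V.dualVec_dotProduct I hiI hjI, if_neg hij, zero_dotProduct, smul_eq_mul] at h1
      simp only [if_true, mul_one, mul_zero, sub_zero] at h1
      exact hv I hI i hi h1
    · rw [sub_dotProduct, smul_dotProduct, smul_dotProduct, smul_eq_mul, smul_eq_mul, h, sub_self]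

/-- With ε_i and σ_i the signs of ⟨u,v_i⟩ - d_i and ⟨u_i^I,v⟩, u lies in the cone of I exactly when
ε_i = σ_i for all i ∈ I \ K. So -(ε_i + σ_i)/2 is -σ_i, the factor of (-1)^I, for a matching sign
and 0 otherwise. -/
lemma DH_eq_chamber (V : Δ.EdgeVectors) (d : ι → ℝ) {v : Fin n → ℝ} {K : Finset ι}
    (hv : V.IsGeneric K v) {u : Fin n → ℝ} (huK : ∀ i ∈ K, u ⬝ᵥ V.rv i = d i)
    (hu0 : ∀ I : Δ.Facet, K ⊆ I.1 → ∀ i ∈ I.1 \ K, u ⬝ᵥ V.rv i ≠ d i) :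
    V.DH d v K u = (-1 / 2) ^ (n - K.card) *
      V.chamber K (fun i => Real.sign (u ⬝ᵥ V.rv i - d i)) v := by
  rw [DH, chamber, Finset.sum_filter, Finset.mul_sum]
  refine Finset.sum_congr rfl fun I _ => ?_
  by_cases hI : K ⊆ I.1
  · rw [if_pos hI, V.sign_eq_prod hv I hI, ← card_facet_sdiff I hI, mul_left_comm,
      ← Finset.prod_const, ← Finset.prod_mul_distrib]
    by_cases hmem : u ∈ V.dualCone d v K I.1
    · rw [if_pos ⟨hI, hmem⟩, mul_comm]
      congr 1
      refine Finset.prod_congr rfl fun i hi => ?_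
      have h1 := ((V.mem_dualCone_iff d hv I hI u).1 hmem).2 i hi
      have h2 := sub_ne_zero.2 (hu0 I hI i hi)
      have h3 := hv I hI i hi
      rcases lt_or_gt_of_ne h2 with ha | ha <;> rcases lt_or_gt_of_ne h3 with hb | hb
      · rw [Real.sign_of_neg ha, Real.sign_of_neg hb]; norm_num
      · rw [Real.sign_of_pos hb] at h1; linarith
      · rw [Real.sign_of_neg hb] at h1; linarith
      · rw [Real.sign_of_pos ha, Real.sign_of_pos hb]; norm_num
    · rw [if_neg fun h => hmem h.2]
      have hex : ∃ i ∈ I.1 \ K,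
          Real.sign (V.dualVec I.1 i ⬝ᵥ v) * (u ⬝ᵥ V.rv i - d i) < 0 := by
        by_contra! h
        exact hmem ((V.mem_dualCone_iff d hv I hI u).2 ⟨huK, h⟩)
      obtain ⟨i, hi, hlt⟩ := hex
      rw [Finset.prod_eq_zero hi, mul_zero]
      rcases lt_or_gt_of_ne (hv I hI i hi) with hb | hb
      · rw [Real.sign_of_neg hb] at hlt ⊢
        rw [Real.sign_of_pos (by linarith)]; norm_num
      · rw [Real.sign_of_pos hb] at hlt ⊢
        rw [Real.sign_of_neg (by linarith)]; norm_num
  · rw [if_neg hI, if_neg fun h => hI h.1, mul_zero]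

/-- The Duistermaat–Heckman function vanishes far from the vertices, at generic points. -/
lemma DH_eq_zero (hΔ : Δ.IsComplete) (V : Δ.EdgeVectors) (d : ι → ℝ) {K : Finset ι}
    {v : Fin n → ℝ} (hv : V.IsGeneric K v) {u : Fin n → ℝ}
    (huK : ∀ i ∈ K, u ⬝ᵥ V.rv i = d i)
    (hu0 : ∀ I : Δ.Facet, K ⊆ I.1 → ∀ i ∈ I.1 \ K, u ⬝ᵥ V.rv i ≠ d i)
    (hu : ∀ I : Δ.Facet, K ⊆ I.1 → V.vertex d I.1 ⬝ᵥ u < u ⬝ᵥ u) :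
    V.DH d v K u = 0 := by
  rw [V.DH_eq_chamber d hv huK hu0, chamber_eq_zero hΔ V d K hv huK hu0 hu, mul_zero]

end SimplicialMultiFan.EdgeVectors

end MultiFan
end

/-! ### Lattices, indices and the orders of the groups H. -/

noncomputable section

namespace MultiFan

/-- The index of the lattice spanned by the rows of a nonsingular integer matrix. -/
lemma index_span_range {κ : Type*} [Fintype κ] [DecidableEq κ] (w : κ → κ → ℤ)
    (hw : LinearIndependent ℤ w) :
    (Submodule.span ℤ (Set.range w)).toAddSubgroup.index = (Matrix.of w).det.natAbs := by
  have h := Submodule.natAbs_det_basis_change (Pi.basisFun ℤ κ)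
    (Submodule.span ℤ (Set.range w)) (Module.Basis.span hw)
  rw [Pi.basisFun_det] at h
  have h2 : (fun i => ((Module.Basis.span hw i : Submodule.span ℤ (Set.range w)) : κ → ℤ)) = w := by
    funext i
    rw [Module.Basis.span_apply]
  rw [show (Submodule.span ℤ (Set.range w)).toAddSubgroup.index =
    Nat.card ((κ → ℤ) ⧸ Submodule.span ℤ (Set.range w)) from rfl, ← h]
  change _ = Int.natAbs (Matrix.detRowAlternating _)
  congr 2

lemma det_ne_zero_of_linearIndependent {κ : Type*} [Fintype κ] [DecidableEq κ] (w : κ → κ → ℤ)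
    (hw : LinearIndependent ℤ w) : (Matrix.of w).det ≠ 0 := by
  intro h
  obtain ⟨c, hc, hc0⟩ := Matrix.exists_vecMul_eq_zero_iff.2 h
  apply hc
  rw [Fintype.linearIndependent_iff] at hw
  funext i
  refine hw c ?_ i
  rw [← hc0, Matrix.vecMul_eq_sum]
  rfl

section Saturated

variable {n : ℕ} {L : Submodule ℤ (Fin n → ℤ)}

lemma free_quotient_of_saturated (hL : ∀ (m : ℤ) (x : Fin n → ℤ), m ≠ 0 → m • x ∈ L → x ∈ L) :
    Module.Free ℤ ((Fin n → ℤ) ⧸ L) := by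
  have : Module.IsTorsionFree ℤ ((Fin n → ℤ) ⧸ L) := by
    refine Module.IsTorsionFree.of_smul_eq_zero fun m x h => ?_
    obtain ⟨x, rfl⟩ := Submodule.Quotient.mk_surjective L x
    rw [← Submodule.Quotient.mk_smul, Submodule.Quotient.mk_eq_zero] at h
    rw [Submodule.Quotient.mk_eq_zero]
    by_cases hm : m = 0
    · exact Or.inl hm
    · exact Or.inr (hL m x hm h)
  infer_instance

/-- A functional on a saturated sublattice extends to the whole lattice. -/
lemma exists_dotProduct_eq_of_saturated
    (hL : ∀ (m : ℤ) (x : Fin n → ℤ), m ≠ 0 → m • x ∈ L → x ∈ L) (f : L →ₗ[ℤ] ℤ) :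
    ∃ y : Fin n → ℤ, ∀ x : L, (x : Fin n → ℤ) ⬝ᵥ y = f x := by
  have := free_quotient_of_saturated hL
  -- The quotient is free, so it splits off: x ↦ x - s(x mod L) retracts the lattice onto L, and f
  -- is extended by composition.
  obtain ⟨s, hs⟩ := Module.projective_lifting_property L.mkQ LinearMap.id L.mkQ_surjective
  have hmem : ∀ x, ((LinearMap.id : (Fin n → ℤ) →ₗ[ℤ] _) - s ∘ₗ L.mkQ) x ∈ L := by
    intro x
    rw [← Submodule.Quotient.mk_eq_zero, ← Submodule.mkQ_apply]
    have h := LinearMap.congr_fun hs (L.mkQ x)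
    simp only [LinearMap.comp_apply, LinearMap.id_apply] at h
    simp only [LinearMap.sub_apply, LinearMap.comp_apply, LinearMap.id_apply, map_sub]
    rw [h, sub_self]
  let g : (Fin n → ℤ) →ₗ[ℤ] ℤ := f ∘ₗ LinearMap.codRestrict L _ hmem
  obtain ⟨y, hy⟩ := (dotProductEquiv ℤ (Fin n)).surjective g
  refine ⟨y, fun x => ?_⟩
  have h1 : y ⬝ᵥ (x : Fin n → ℤ) = g x := by rw [← hy]; rfl
  rw [dotProduct_comm, h1]
  change f _ = f x
  congr 1
  apply Subtype.ext
  have : L.mkQ (x : Fin n → ℤ) = 0 := by simp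
  rw [LinearMap.codRestrict_apply, LinearMap.sub_apply, LinearMap.comp_apply, this]
  simp

/-- A saturated sublattice is the annihilator of its annihilator. -/
lemma mem_of_saturated (hL : ∀ (m : ℤ) (x : Fin n → ℤ), m ≠ 0 → m • x ∈ L → x ∈ L)
    {y : Fin n → ℤ} (hy : ∀ m : Fin n → ℤ, (∀ x ∈ L, m ⬝ᵥ x = 0) → m ⬝ᵥ y = 0) : y ∈ L := by
  have := free_quotient_of_saturated hL
  rw [← Submodule.Quotient.mk_eq_zero, ← Module.forall_dual_apply_eq_zero_iff ℤ]
  intro f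
  obtain ⟨m, hm⟩ := (dotProductEquiv ℤ (Fin n)).surjective (f ∘ₗ L.mkQ)
  have h : ∀ x, m ⬝ᵥ x = f (L.mkQ x) := fun x => by
    rw [← LinearMap.comp_apply, ← hm]; rfl
  have h2 := hy m fun x hx => by
    rw [h, Submodule.mkQ_apply, (Submodule.Quotient.mk_eq_zero L).2 hx, map_zero]
  rw [← h2, h]
  rfl

end Saturated

section ToReal

variable {n : ℕ}

lemma toReal_dotProduct (x y : Fin n → ℤ) : toReal x ⬝ᵥ toReal y = ((x ⬝ᵥ y : ℤ) : ℝ) := by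
  simp [dotProduct, toReal]

lemma toReal_sum_smul {κ : Type*} (s : Finset κ) (c : κ → ℤ) (x : κ → Fin n → ℤ) :
    toReal (∑ i ∈ s, c i • x i) = ∑ i ∈ s, (c i : ℝ) • toReal (x i) := by
  funext a
  simp [toReal, Finset.sum_apply]

lemma toReal_smul (c : ℤ) (x : Fin n → ℤ) : toReal (c • x) = (c : ℝ) • toReal x := by
  funext a
  simp [toReal]

lemma toReal_add (x y : Fin n → ℤ) : toReal (x + y) = toReal x + toReal y := by
  funext a
  simp [toReal]

lemma toReal_zero : toReal (0 : Fin n → ℤ) = 0 := by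
  funext a
  simp [toReal]

lemma toReal_injective : Function.Injective (toReal (n := n)) := by
  intro x y h
  funext a
  exact Int.cast_injective (congrFun h a)

end ToReal

namespace SimplicialMultiFan

variable {n : ℕ} {ι : Type*} {Δ : SimplicialMultiFan n ι}

lemma latticeN_saturated (K : Finset ι) (m : ℤ) (x : Fin n → ℤ) (hm : m ≠ 0)
    (hx : m • x ∈ Δ.latticeN K) : x ∈ Δ.latticeN K := by
  rw [latticeN, Submodule.mem_sInf] at hx ⊢
  exact fun L hL => hL.1 m x hm (hx L hL)

/-- The lattice points of the span form a saturated sublattice containing N ∩ C(K), so minimality of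
N_K applies. -/
lemma toReal_mem_spanCone {K : Finset ι} {x : Fin n → ℤ} (hx : x ∈ Δ.latticeN K) :
    toReal x ∈ Δ.spanCone K := by
  let L : Submodule ℤ (Fin n → ℤ) :=
    { carrier := {x | toReal x ∈ Δ.spanCone K}
      add_mem' := fun {a b} ha hb => by
        rw [Set.mem_ofPred_eq, toReal_add]
        exact add_mem ha hb
      zero_mem' := by
        rw [Set.mem_ofPred_eq, toReal_zero]
        exact zero_mem _
      smul_mem' := fun c a ha => by
        rw [Set.mem_ofPred_eq, toReal_smul]
        exact Submodule.smul_mem _ _ ha }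
  rw [latticeN, Submodule.mem_sInf] at hx
  refine hx L ⟨fun m x hm hmx => ?_, fun x hx => Submodule.subset_span hx⟩
  have hmx' : toReal (m • x) ∈ Δ.spanCone K := hmx
  rw [toReal_smul] at hmx'
  exact ((Δ.spanCone K).smul_mem_iff (Int.cast_ne_zero.2 hm)).1 hmx'

lemma latticeM_saturated (K : Finset ι) (m : ℤ) (x : Fin n → ℤ) (hm : m ≠ 0)
    (hx : m • x ∈ Δ.latticeM K) : x ∈ Δ.latticeM K := by
  intro y hy
  have h := hx y hy
  rw [smul_dotProduct, smul_eq_mul] at h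
  exact (mul_eq_zero.1 h).resolve_left hm

lemma mem_latticeN_iff (K : Finset ι) (y : Fin n → ℤ) :
    y ∈ Δ.latticeN K ↔ ∀ m ∈ Δ.latticeM K, m ⬝ᵥ y = 0 := by
  constructor
  · exact fun hy m hm => hm y hy
  · exact fun h => mem_of_saturated (latticeN_saturated K) fun m hm => h m hm

/-- The rank of `M_K`. -/
abbrev rankM (Δ : SimplicialMultiFan n ι) (K : Finset ι) : ℕ := Module.finrank ℤ (Δ.latticeM K)

/-- The basis of `M_K` used in `chart`. -/
def basisM (Δ : SimplicialMultiFan n ι) (K : Finset ι) (a : Fin (Δ.rankM K)) : Fin n → ℤ :=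
  (Module.finBasis ℤ (Δ.latticeM K) a : Fin n → ℤ)

/-- The projection `N → N / N_K` in the coordinates dual to `basisM`. -/
def projN (Δ : SimplicialMultiFan n ι) (K : Finset ι) :
    (Fin n → ℤ) →ₗ[ℤ] (Fin (Δ.rankM K) → ℤ) :=
  LinearMap.pi fun a => dotProductEquiv ℤ (Fin n) (Δ.basisM K a)

lemma projN_apply (K : Finset ι) (y : Fin n → ℤ) (a : Fin (Δ.rankM K)) :
    Δ.projN K y a = Δ.basisM K a ⬝ᵥ y := rfl

lemma projN_eq_zero_iff (K : Finset ι) (y : Fin n → ℤ) :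
    Δ.projN K y = 0 ↔ y ∈ Δ.latticeN K := by
  rw [mem_latticeN_iff]
  constructor
  · intro h m hm
    have hrepr := (Module.finBasis ℤ (Δ.latticeM K)).sum_repr ⟨m, hm⟩
    have hm' : m = ∑ a, (Module.finBasis ℤ (Δ.latticeM K)).repr ⟨m, hm⟩ a • Δ.basisM K a := by
      have := congrArg (Submodule.subtype _) hrepr
      rw [map_sum] at this
      simpa [basisM] using this.symm
    rw [hm', sum_dotProduct]
    refine Finset.sum_eq_zero fun a _ => ?_
    rw [smul_dotProduct, ← projN_apply, h, Pi.zero_apply, smul_zero]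
  · intro h
    funext a
    exact h _ (Module.finBasis ℤ (Δ.latticeM K) a).2

/-- M_K is saturated in M, so every functional on M_K is the pairing with some y ∈ N. Together with
`projN_eq_zero_iff` this identifies N / N_K with the dual of M_K. -/
lemma projN_surjective (K : Finset ι) : Function.Surjective (Δ.projN K) := by
  intro z
  obtain ⟨y, hy⟩ := exists_dotProduct_eq_of_saturated (latticeM_saturated (Δ := Δ) K)
    ((Module.finBasis ℤ (Δ.latticeM K)).constr ℤ z)
  refine ⟨y, funext fun a => ?_⟩
  rw [projN_apply, basisM, hy, Module.Basis.constr_basis]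

namespace EdgeVectors

lemma v_mem_latticeN (V : Δ.EdgeVectors) {K : Finset ι} (hK : K ∈ Δ.simplices) {i : ι} (hi : i ∈ K) :
    V.v i ∈ Δ.latticeN K := by
  rw [latticeN, Submodule.mem_sInf]
  refine fun L hL => hL.2 _ ?_
  rw [V.cone_eq_hull hK]
  exact Submodule.subset_span ⟨i, hi, rfl⟩

lemma mem_latticeNV_iff (V : Δ.EdgeVectors) {K : Finset ι} {x : Fin n → ℤ} :
    x ∈ V.latticeNV K ↔ ∃ c : ι → ℤ, ∑ i ∈ K, c i • V.v i = x := by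
  classical
  rw [latticeNV, Submodule.mem_span_image_finset_iff_exists_fun]
  constructor
  · rintro ⟨c, rfl⟩
    refine ⟨fun i => if h : i ∈ K then c ⟨i, h⟩ else 0, ?_⟩
    rw [← Finset.sum_coe_sort]
    refine Finset.sum_congr rfl fun j _ => ?_
    simp
  · rintro ⟨c, rfl⟩
    exact ⟨fun i => c i, Finset.sum_coe_sort K fun i => c i • V.v i⟩

lemma latticeNV_mono (V : Δ.EdgeVectors) {K I : Finset ι} (h : K ⊆ I) : V.latticeNV K ≤ V.latticeNV I :=
  Submodule.span_mono (Set.image_mono (by exact_mod_cast h))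

lemma natCard_H (V : Δ.EdgeVectors) (K : Finset ι) :
    Nat.card (V.H K) = (V.latticeNV K).toAddSubgroup.relIndex (Δ.latticeN K).toAddSubgroup := rfl

lemma linearIndependent_v (V : Δ.EdgeVectors) (I : Δ.Facet) : LinearIndependent ℤ (fun i : I.1 => V.v i) := by
  rw [Fintype.linearIndependent_iff]
  intro c hc i
  have hr := Fintype.linearIndependent_iff.1 (V.linearIndependent_rv I.2.1) (fun i => (c i : ℝ)) (by
    have := congrArg toReal hc
    rwa [toReal_sum_smul, toReal_zero] at this) i
  exact_mod_cast hr

/-- `index` is 0 for infinite index, so this says that the edge vectors of a facet span a sublattice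
of finite index. -/
lemma index_latticeNV_ne_zero (V : Δ.EdgeVectors) (I : Δ.Facet) : (V.latticeNV I.1).toAddSubgroup.index ≠ 0 := by
  have hcard : Fintype.card (Fin n) = Fintype.card I.1 := by simp [I.2.2]
  obtain ⟨e⟩ := Fintype.card_eq.1 hcard
  have hli : LinearIndependent ℤ (fun a => V.v (e a) : Fin n → Fin n → ℤ) :=
    (V.linearIndependent_v I).comp e e.injective
  have hspan : V.latticeNV I.1 =
      Submodule.span ℤ (Set.range (fun a => V.v (e a) : Fin n → Fin n → ℤ)) := by
    rw [latticeNV]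
    congr 1
    ext x
    constructor
    · rintro ⟨i, hi, rfl⟩
      exact ⟨e.symm ⟨i, hi⟩, by simp⟩
    · rintro ⟨a, rfl⟩
      exact ⟨e a, (e a).2, rfl⟩
  rw [hspan, index_span_range _ hli, Int.natAbs_ne_zero]
  exact det_ne_zero_of_linearIndependent _ hli

/-- The index of the edge lattice multiplies every lattice point into N_I, which is saturated. -/
lemma latticeN_facet (V : Δ.EdgeVectors) (I : Δ.Facet) : Δ.latticeN I.1 = ⊤ := by
  rw [eq_top_iff]
  intro x _
  refine latticeN_saturated I.1 ((V.latticeNV I.1).toAddSubgroup.index : ℤ) x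
    (by exact_mod_cast V.index_latticeNV_ne_zero I) ?_
  have h : (V.latticeNV I.1).toAddSubgroup.index • x ∈ (V.latticeNV I.1).toAddSubgroup :=
    AddSubgroup.nsmul_index_mem _ _
  have hle : V.latticeNV I.1 ≤ Δ.latticeN I.1 := by
    rw [latticeNV, Submodule.span_le]
    rintro _ ⟨i, hi, rfl⟩
    exact V.v_mem_latticeN I.2.1 hi
  rw [natCast_zsmul]
  exact hle h

lemma natCard_H_facet (V : Δ.EdgeVectors) (I : Δ.Facet) :
    Nat.card (V.H I.1) = (V.latticeNV I.1).toAddSubgroup.index := by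
  rw [natCard_H, V.latticeN_facet I]
  exact AddSubgroup.relIndex_top_right _

lemma natCard_H_facet_ne_zero (V : Δ.EdgeVectors) (I : Δ.Facet) : Nat.card (V.H I.1) ≠ 0 := by
  rw [V.natCard_H_facet]
  exact V.index_latticeNV_ne_zero I

variable [DecidableEq ι]

lemma dualVec_eq_zero_of_mem_spanCone (V : Δ.EdgeVectors) (I : Δ.Facet) {K : Finset ι} (hI : K ⊆ I.1)
    {p : Fin n → ℝ} (hp : p ∈ Δ.spanCone K) {i : ι} (hi : i ∈ I.1 \ K) :
    V.dualVec I.1 i ⬝ᵥ p = 0 := by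
  rw [Finset.mem_sdiff] at hi
  rw [V.spanCone_eq (Δ.down_closed _ I.2.1 _ hI)] at hp
  rw [← V.mem_spanCone_erase I hi.1,
    V.spanCone_eq (Δ.down_closed _ I.2.1 _ (Finset.erase_subset i I.1))]
  refine Submodule.span_mono (Set.image_mono ?_) hp
  intro j hj
  have hj' : j ∈ K := by exact_mod_cast hj
  have : j ∈ I.1.erase i := Finset.mem_erase.2 ⟨fun h => hi.2 (h ▸ hj'), hI hj'⟩
  exact_mod_cast this

/-- The form u_i^I reads off the coefficient and vanishes on the span of C(K), which contains N_K.
-/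
lemma coeff_eq_zero (V : Δ.EdgeVectors) (I : Δ.Facet) {K : Finset ι} (hI : K ⊆ I.1) {c : ι → ℤ} {s : Finset ι}
    (hs : s ⊆ I.1) (hc : ∑ i ∈ s, c i • V.v i ∈ Δ.latticeN K) {i : ι} (hi : i ∈ s)
    (hiK : i ∉ K) : c i = 0 := by
  have h := V.dualVec_eq_zero_of_mem_spanCone I hI (toReal_mem_spanCone hc)
    (Finset.mem_sdiff.2 ⟨hs hi, hiK⟩)
  rw [toReal_sum_smul, dotProduct_sum, Finset.sum_eq_single_of_mem i hi] at h
  · have h1 : V.dualVec I.1 i ⬝ᵥ toReal (V.v i) = 1 := by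
      have := V.dualVec_dotProduct I (hs hi) (hs hi)
      rwa [if_pos rfl] at this
    rw [dotProduct_smul, h1, smul_eq_mul, mul_one] at h
    exact_mod_cast h
  · intro j hj hji
    have h1 : V.dualVec I.1 i ⬝ᵥ toReal (V.v j) = 0 := by
      have := V.dualVec_dotProduct I (hs hi) (hs hj)
      rwa [if_neg hji.symm] at this
    rw [dotProduct_smul, h1, smul_zero]

lemma linearIndependent_projN (V : Δ.EdgeVectors) (I : Δ.Facet) {K : Finset ι} (hI : K ⊆ I.1) :
    LinearIndependent ℤ (fun i : ↥(I.1 \ K) => Δ.projN K (V.v i)) := by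
  rw [Fintype.linearIndependent_iff]
  intro c hc i
  have h : ∑ i ∈ I.1 \ K, (fun i => if h : i ∈ I.1 \ K then c ⟨i, h⟩ else 0) i • V.v i ∈
      Δ.latticeN K := by
    rw [← projN_eq_zero_iff, ← hc, map_sum, ← Finset.sum_coe_sort]
    refine Finset.sum_congr rfl fun j _ => ?_
    rw [map_smul]
    simp only [dif_pos j.2]
  have := V.coeff_eq_zero I hI Finset.sdiff_subset h i.2 (Finset.mem_sdiff.1 i.2).2
  simpa only [dif_pos i.2] using this

/-- M_K embeds into ℤ^{I \ K} by the pairings with the v_i; conversely the images of these v_i under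
`projN` are independent. -/
lemma rankM_eq (V : Δ.EdgeVectors) (I : Δ.Facet) {K : Finset ι} (hI : K ⊆ I.1) :
    Δ.rankM K = (I.1 \ K).card := by
  apply le_antisymm
  · let f : Δ.latticeM K →ₗ[ℤ] (↥(I.1 \ K) → ℤ) :=
      (LinearMap.pi fun i => dotProductEquiv ℤ (Fin n) (V.v i)) ∘ₗ (Δ.latticeM K).subtype
    have hf : Function.Injective f := by
      rw [← LinearMap.ker_eq_bot, LinearMap.ker_eq_bot']
      intro m hm
      apply Subtype.ext
      apply toReal_injective
      rw [V.eq_sum_smul_dualVec I (toReal (m : Fin n → ℤ)), ZeroMemClass.coe_zero, toReal_zero]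
      refine Finset.sum_eq_zero fun i hi => ?_
      have h0 : (m : Fin n → ℤ) ⬝ᵥ V.v i = 0 := by
        by_cases hiK : i ∈ K
        · exact m.2 _ (V.v_mem_latticeN (Δ.down_closed _ I.2.1 _ hI) hiK)
        · rw [dotProduct_comm]
          exact congrFun hm ⟨i, Finset.mem_sdiff.2 ⟨hi, hiK⟩⟩
      rw [rv, toReal_dotProduct, h0, Int.cast_zero, zero_smul]
    have := LinearMap.finrank_le_finrank_of_injective hf
    simpa using this
  · have := (V.linearIndependent_projN I hI).fintype_card_le_finrank
    simpa using this

/-- An enumeration of `I \ K`. -/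
def enumSdiff (V : Δ.EdgeVectors) (I : Δ.Facet) {K : Finset ι} (hI : K ⊆ I.1) : Fin (Δ.rankM K) ≃ ↥(I.1 \ K) :=
  (finCongr (V.rankM_eq I hI)).trans (I.1 \ K).equivFin.symm

/-- The matrix of the pairings of `v_i`, `i ∈ I \ K`, with the basis of `M_K`. -/
def pairing (V : Δ.EdgeVectors) (I : Δ.Facet) {K : Finset ι} (hI : K ⊆ I.1) :
    Matrix (Fin (Δ.rankM K)) (Fin (Δ.rankM K)) ℤ :=
  Matrix.of fun b => Δ.projN K (V.v (V.enumSdiff I hI b))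

lemma linearIndependent_pairing (V : Δ.EdgeVectors) (I : Δ.Facet) {K : Finset ι} (hI : K ⊆ I.1) :
    LinearIndependent ℤ (fun b => Δ.projN K (V.v (V.enumSdiff I hI b))) :=
  (V.linearIndependent_projN I hI).comp _ (V.enumSdiff I hI).injective

lemma det_pairing_ne_zero (V : Δ.EdgeVectors) (I : Δ.Facet) {K : Finset ι} (hI : K ⊆ I.1) :
    (V.pairing I hI).det ≠ 0 :=
  det_ne_zero_of_linearIndependent _ (V.linearIndependent_pairing I hI)

/-- `|H_I| = |H_K| · |det(⟨b_a, v_i⟩)|`. -/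
lemma natCard_H_facet_eq_mul (V : Δ.EdgeVectors) (I : Δ.Facet) {K : Finset ι} (hI : K ⊆ I.1) :
    Nat.card (V.H I.1) = Nat.card (V.H K) * (V.pairing I hI).det.natAbs := by
  have hK := Δ.down_closed _ I.2.1 _ hI
  set LI := (V.latticeNV I.1).toAddSubgroup with hLI
  set LK := (V.latticeNV K).toAddSubgroup with hLK
  set NK := (Δ.latticeN K).toAddSubgroup with hNK
  -- The index of LI factors through LI + NK. The lower factor is [NK : LI ∩ NK] = |H_K| by this
  -- equality; the upper one is the index of the image of LI in N / N_K, a determinant.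
  have hinf : LI ⊓ NK = LK ⊓ NK := by
    apply le_antisymm
    · rintro x ⟨hx, hxN⟩
      refine ⟨?_, hxN⟩
      obtain ⟨c, rfl⟩ := V.mem_latticeNV_iff.1 hx
      refine V.mem_latticeNV_iff.2 ⟨c, Finset.sum_subset hI fun i hi hiK => ?_⟩
      rw [V.coeff_eq_zero I hI subset_rfl hxN hi hiK, zero_smul]
    · exact inf_le_inf_right _ (V.latticeNV_mono hI)
  have hrel : LI.relIndex NK = Nat.card (V.H K) := by
    rw [natCard_H, ← AddSubgroup.inf_relIndex_right, hinf, AddSubgroup.inf_relIndex_right]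
  have hker : (Δ.projN K).toAddMonoidHom.ker = NK := by
    ext y
    exact projN_eq_zero_iff K y
  have hrange : (Δ.projN K).toAddMonoidHom.range = ⊤ :=
    AddMonoidHom.range_eq_top.2 (projN_surjective K)
  have hmap : LI.map (Δ.projN K).toAddMonoidHom =
      (Submodule.span ℤ (Set.range fun b => Δ.projN K (V.v (V.enumSdiff I hI b)))).toAddSubgroup := by
    have h1 : (V.latticeNV I.1).map (Δ.projN K) =
        Submodule.span ℤ (Set.range fun b => Δ.projN K (V.v (V.enumSdiff I hI b))) := by
      rw [latticeNV, Submodule.map_span]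
      apply le_antisymm
      · rw [Submodule.span_le]
        rintro _ ⟨_, ⟨i, hi, rfl⟩, rfl⟩
        by_cases hiK : i ∈ K
        · rw [(projN_eq_zero_iff K _).2 (V.v_mem_latticeN hK hiK)]
          exact zero_mem _
        · exact Submodule.subset_span
            ⟨(V.enumSdiff I hI).symm ⟨i, Finset.mem_sdiff.2 ⟨hi, hiK⟩⟩, by simp⟩
      · apply Submodule.span_mono
        rintro _ ⟨b, rfl⟩
        exact ⟨_, ⟨_, (Finset.mem_sdiff.1 (V.enumSdiff I hI b).2).1, rfl⟩, rfl⟩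
    rw [← h1]
    rfl
  have hidx : (LI ⊔ NK).index = (V.pairing I hI).det.natAbs := by
    have := AddSubgroup.index_map LI (Δ.projN K).toAddMonoidHom
    rw [hrange, AddSubgroup.index_top, mul_one, hker, hmap,
      index_span_range _ (V.linearIndependent_pairing I hI)] at this
    exact this.symm
  rw [V.natCard_H_facet I, ← AddSubgroup.relIndex_mul_index (le_sup_left : LI ≤ LI ⊔ NK), hidx,
    sup_comm, AddSubgroup.relIndex_sup_right, hrel]

lemma natCard_H_ne_zero (V : Δ.EdgeVectors) {K : Finset ι} (hK : K ∈ Δ.simplices) : Nat.card (V.H K) ≠ 0 := by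
  obtain ⟨I, hI, hKI, hcard⟩ := Δ.pure K hK
  have h := V.natCard_H_facet_ne_zero ⟨I, hI, hcard⟩
  rw [V.natCard_H_facet_eq_mul ⟨I, hI, hcard⟩ hKI] at h
  exact left_ne_zero_of_mul h

end EdgeVectors

end SimplicialMultiFan

end MultiFan
end

/-! ### Power series, Laplace transforms of cones and moment generating functions. -/

noncomputable section

namespace MultiFan

open MeasureTheory Filter Topology

/-- A real power series which vanishes on `(0, 1]` is zero. -/
lemma coeff_eq_zero_of_hasSum_zero {c : ℕ → ℝ}
    (h : ∀ s : ℝ, 0 < s → s ≤ 1 → HasSum (fun m => c m * s ^ m) 0) (m : ℕ) : c m = 0 := by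
  let p : FormalMultilinearSeries ℝ ℝ ℝ := FormalMultilinearSeries.ofScalars ℝ c
  have hsum : Summable fun m => ‖c m‖ := by
    have := (h 1 one_pos le_rfl).summable.norm
    simpa using this
  have hr : (1 : NNReal) ≤ p.radius := by
    apply p.le_radius_of_summable_norm
    simpa [p, FormalMultilinearSeries.ofScalars_norm] using hsum
  have hpos : 0 < p.radius := lt_of_lt_of_le (by simp) hr
  have hfp := (p.hasFPowerSeriesOnBall hpos).hasFPowerSeriesAt
  have hz : ∀ s : ℝ, 0 < s → s ≤ 1 → p.sum s = 0 := by
    intro s hs hs1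
    have : p.sum s = ∑' m, c m * s ^ m := by
      simp [p, FormalMultilinearSeries.sum, mul_comm]
    rw [this, (h s hs hs1).tsum_eq]
  -- The zeros in (0, 1] accumulate at 0, so the identity theorem for analytic functions applies.
  have hfreq : ∃ᶠ s in 𝓝[≠] (0 : ℝ), p.sum s = 0 := by
    have h1 : ∃ᶠ s in 𝓝[>] (0 : ℝ), p.sum s = 0 := by
      apply Eventually.frequently
      filter_upwards [Ioc_mem_nhdsGT (one_pos : (0 : ℝ) < 1)] with s hs
      exact hz s hs.1 hs.2
    exact h1.filter_mono (nhdsWithin_mono _ fun s hs => ne_of_gt hs)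
  have hp : p = 0 := hfp.locally_zero_iff.1
    (hfp.analyticAt.frequently_zero_iff_eventually_zero.1 hfreq)
  have hc : c = 0 := (FormalMultilinearSeries.ofScalars_series_eq_zero ℝ).1 hp
  rw [hc, Pi.zero_apply]

section ConeIntegral

variable {κ : Type*} [Fintype κ] [DecidableEq κ]

lemma hasIntegral_exp_Ici {k : ℝ} (hk : k < 0) :
    Integrable ((Set.Ici (0 : ℝ)).indicator fun x => Real.exp (k * x)) ∧
      ∫ x, (Set.Ici (0 : ℝ)).indicator (fun x => Real.exp (k * x)) x = -k⁻¹ := by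
  constructor
  · rw [integrable_indicator_iff measurableSet_Ici, integrableOn_Ici_iff_integrableOn_Ioi]
    exact integrableOn_exp_mul_Ioi hk 0
  · rw [integral_indicator measurableSet_Ici, integral_Ici_eq_integral_Ioi,
      integral_exp_mul_Ioi hk]
    simp [neg_div]

/-- The Laplace transform of a simplicial cone. -/
lemma integral_exp_simplicialCone {M : Matrix κ κ ℝ} (hM : M.det ≠ 0) (β k : κ → ℝ)
    (hk : ∀ b, k b < 0) :
    Integrable ({t : κ → ℝ | ∀ b, 0 ≤ (M *ᵥ t) b + β b}.indicator
      fun t => Real.exp (∑ b, k b * ((M *ᵥ t) b + β b))) ∧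
    ∫ t, {t : κ → ℝ | ∀ b, 0 ≤ (M *ᵥ t) b + β b}.indicator
      (fun t => Real.exp (∑ b, k b * ((M *ᵥ t) b + β b))) t = |M.det|⁻¹ * ∏ b, -(k b)⁻¹ := by
  -- In the coordinates y = M t + β the cone is the positive orthant and the integrand a product of
  -- functions of one variable.
  set g : (κ → ℝ) → ℝ := fun y =>
    ∏ b, (Set.Ici (0 : ℝ)).indicator (fun x => Real.exp (k b * x)) (y b) with hg
  have hgi : Integrable g :=
    Integrable.fintype_prod fun b => (hasIntegral_exp_Ici (hk b)).1
  have hgv : ∫ y, g y = ∏ b, -(k b)⁻¹ := by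
    rw [hg, integral_fintype_prod_volume_eq_prod
      (fun b x => (Set.Ici (0 : ℝ)).indicator (fun x => Real.exp (k b * x)) x)]
    exact Finset.prod_congr rfl fun b _ => (hasIntegral_exp_Ici (hk b)).2
  have hfun : ({t : κ → ℝ | ∀ b, 0 ≤ (M *ᵥ t) b + β b}.indicator
      fun t => Real.exp (∑ b, k b * ((M *ᵥ t) b + β b))) =
      fun t => g (Matrix.toLin' M t + β) := by
    funext t
    by_cases ht : ∀ b, 0 ≤ (M *ᵥ t) b + β b
    · rw [Set.indicator_of_mem (by exact ht), hg, Real.exp_sum]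
      refine Finset.prod_congr rfl fun b _ => ?_
      rw [Set.indicator_of_mem]
      · rfl
      · exact ht b
    · rw [Set.indicator_of_notMem (by exact ht), hg]
      push Not at ht
      obtain ⟨b, hb⟩ := ht
      refine (Finset.prod_eq_zero (Finset.mem_univ b) ?_).symm
      exact Set.indicator_of_notMem (by simpa using hb) _
  have hmeas : Measurable (Matrix.toLin' M) :=
    (LinearMap.continuous_of_finiteDimensional _).measurable
  have hshift : Integrable (fun y => g (y + β)) := hgi.comp_add_right β
  have hmap := Real.map_matrix_volume_pi_eq_smul_volume_pi hM
  have hshift' : Integrable (fun y => g (y + β)) (Measure.map (Matrix.toLin' M) volume) := by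
    rw [hmap]
    exact hshift.smul_measure ENNReal.ofReal_ne_top
  rw [hfun]
  constructor
  · exact hshift'.comp_measurable hmeas
  · rw [← integral_map (f := fun y => g (y + β)) hmeas.aemeasurable hshift'.aestronglyMeasurable,
      hmap, integral_smul_measure, integral_add_right_eq_self, hgv,
      ENNReal.toReal_ofReal (abs_nonneg _), abs_inv, smul_eq_mul]

/-- The preimage of a coordinate hyperplane under an invertible affine map is a null set. -/
lemma ae_mulVec_ne {M : Matrix κ κ ℝ} (hM : M.det ≠ 0) (b : κ) (c : ℝ) :
    ∀ᵐ t : κ → ℝ, (M *ᵥ t) b ≠ c := by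
  have hmeas : Measurable (Matrix.toLin' M) :=
    (LinearMap.continuous_of_finiteDimensional _).measurable
  have h0 : volume {y : κ → ℝ | y b = c} = 0 := by
    rw [volume_pi]
    exact Measure.pi_hyperplane (fun _ => (volume : Measure ℝ)) b c
  have h1 : ∀ᵐ y ∂(Measure.map (Matrix.toLin' M) volume), y b ≠ c := by
    rw [Real.map_matrix_volume_pi_eq_smul_volume_pi hM]
    exact (measure_eq_zero_iff_ae_notMem.1 h0).filter_mono (Measure.ae_smul_measure_le _)
  exact ae_of_ae_map hmeas.aemeasurable h1

end ConeIntegral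

/-- The exponential moment generating function of a weight with support where `f` is bounded. -/
lemma hasSum_integral_exp {X : Type*} [MeasurableSpace X] {μ : Measure X} {f ψ : X → ℝ} {R : ℝ}
    (hf : AEStronglyMeasurable f μ) (hψ : Integrable ψ μ)
    (hR : ∀ᵐ t ∂μ, ψ t ≠ 0 → |f t| ≤ R) (s : ℝ) :
    HasSum (fun j : ℕ => ((j.factorial : ℝ)⁻¹ * ∫ t, f t ^ j * ψ t ∂μ) * s ^ j)
      (∫ t, Real.exp (s * f t) * ψ t ∂μ) := by
  have hF : ∀ j : ℕ, ((j.factorial : ℝ)⁻¹ * ∫ t, f t ^ j * ψ t ∂μ) * s ^ j =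
      ∫ t, ((s * f t) ^ j / j.factorial) * ψ t ∂μ := by
    intro j
    rw [← integral_const_mul, ← integral_mul_const]
    congr 1
    funext t
    rw [mul_pow]
    ring
  simp_rw [hF]
  -- On the support of ψ the exponential series is dominated termwise by that of e^{|s|R}.
  refine hasSum_integral_of_dominated_convergence
    (fun j t => (|s| * R) ^ j / j.factorial * ‖ψ t‖) ?_ ?_ ?_ ?_ ?_
  · intro j
    have h1 : AEStronglyMeasurable (fun t => (s * f t) ^ j / (j.factorial : ℝ)) μ := by
      simp_rw [div_eq_mul_inv]
      exact ((hf.const_mul s).pow j).mul_const _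
    exact h1.mul hψ.aestronglyMeasurable
  · intro j
    filter_upwards [hR] with t ht
    by_cases h0 : ψ t = 0
    · simp [h0]
    · rw [norm_mul, norm_div, norm_pow, Real.norm_natCast, norm_mul, Real.norm_eq_abs,
        Real.norm_eq_abs]
      have := ht h0
      gcongr
  · exact Eventually.of_forall fun t => (Real.summable_pow_div_factorial _).mul_right _
  · simp_rw [tsum_mul_right]
    exact hψ.norm.const_mul _
  · refine Eventually.of_forall fun t => ?_
    have := NormedSpace.expSeries_div_hasSum_exp (𝔸 := ℝ) (s * f t)
    rw [← Real.exp_eq_exp_ℝ] at this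
    exact this.mul_right _

lemma integrable_bdd_mul_of_support {X : Type*} [MeasurableSpace X] {μ : Measure X} {f ψ : X → ℝ} {R : ℝ}
    (hf : AEStronglyMeasurable f μ) (hψ : Integrable ψ μ)
    (hR : ∀ᵐ t ∂μ, ψ t ≠ 0 → |f t| ≤ R) : Integrable (fun t => f t * ψ t) μ := by
  refine (hψ.norm.const_mul R).mono (hf.mul hψ.aestronglyMeasurable) ?_
  filter_upwards [hR] with t ht
  by_cases h0 : ψ t = 0
  · simp [h0]
  · rw [norm_mul, norm_mul, norm_norm, Real.norm_eq_abs (f t), Real.norm_eq_abs R]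
    exact mul_le_mul_of_nonneg_right ((ht h0).trans (le_abs_self R)) (norm_nonneg _)

/-- Comparison of the coefficients of an exponential sum and of a moment generating function. -/
lemma exp_sum_coeff {X : Type*} [MeasurableSpace X] {μ : Measure X} {f ψ : X → ℝ} {R : ℝ}
    (hf : AEStronglyMeasurable f μ) (hψ : Integrable ψ μ)
    (hR : ∀ᵐ t ∂μ, ψ t ≠ 0 → |f t| ≤ R) {κ : Type*} (S : Finset κ) (A c : κ → ℝ) (r : ℕ)
    (h : ∀ s : ℝ, 0 < s → s ^ r * ∫ t, Real.exp (s * f t) * ψ t ∂μ =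
      ∑ x ∈ S, A x * Real.exp (s * c x)) (m : ℕ) :
    ∑ x ∈ S, A x * (c x ^ m / m.factorial) =
      if m < r then 0 else ((m - r).factorial : ℝ)⁻¹ * ∫ t, f t ^ (m - r) * ψ t ∂μ := by
  rw [← sub_eq_zero]
  refine coeff_eq_zero_of_hasSum_zero (c := fun m => ∑ x ∈ S, A x * (c x ^ m / m.factorial) -
    if m < r then 0 else ((m - r).factorial : ℝ)⁻¹ * ∫ t, f t ^ (m - r) * ψ t ∂μ)
    (fun s hs _ => ?_) m
  have h1 : HasSum (fun m => (∑ x ∈ S, A x * (c x ^ m / m.factorial)) * s ^ m)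
      (∑ x ∈ S, A x * Real.exp (s * c x)) := by
    simp_rw [Finset.sum_mul]
    refine hasSum_sum fun x _ => ?_
    have := NormedSpace.expSeries_div_hasSum_exp (𝔸 := ℝ) (s * c x)
    rw [← Real.exp_eq_exp_ℝ] at this
    refine Eq.subst (motive := fun g => HasSum g _) (funext fun j => ?_) (this.mul_left (A x))
    rw [mul_pow]
    ring
  have h2 : HasSum (fun m => (if m < r then 0 else
      ((m - r).factorial : ℝ)⁻¹ * ∫ t, f t ^ (m - r) * ψ t ∂μ) * s ^ m)
      (s ^ r * ∫ t, Real.exp (s * f t) * ψ t ∂μ) := by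
    have h3 := (hasSum_integral_exp hf hψ hR s).mul_left (s ^ r)
    -- The factor s^r moves the series up by r places; the first r coefficients are 0.
    have h4 := (hasSum_nat_add_iff (f := fun m => (if m < r then 0 else
      ((m - r).factorial : ℝ)⁻¹ * ∫ t, f t ^ (m - r) * ψ t ∂μ) * s ^ m)
      (g := s ^ r * ∫ t, Real.exp (s * f t) * ψ t ∂μ) r).1 (by
        refine Eq.subst (motive := fun g => HasSum g _) (funext fun j => ?_) h3
        rw [if_neg (by omega), Nat.add_sub_cancel, pow_add]
        ring)
    rwa [Finset.sum_eq_zero (fun j hj => by rw [if_pos (Finset.mem_range.1 hj), zero_mul]),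
      add_zero] at h4
  have h5 := h1.sub h2
  rw [h s hs, sub_self] at h5
  simpa only [sub_mul] using h5

end MultiFan
end

/-! ### Laplace transform, support and moments of the Duistermaat–Heckman function. -/

noncomputable section

namespace MultiFan

open MeasureTheory Filter Topology

namespace SimplicialMultiFan.EdgeVectors

variable {n : ℕ} {ι : Type*} {Δ : SimplicialMultiFan n ι}

lemma chart_continuous (V : Δ.EdgeVectors) (d : ι → ℝ) (K : Finset ι) :
    Continuous (V.chart d K) := by
  unfold chart
  fun_prop

lemma chart_dotProduct_rv (V : Δ.EdgeVectors) (d : ι → ℝ) (K : Finset ι)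
    (t : Fin (Δ.rankM K) → ℝ) (i : ι) :
    V.chart d K t ⬝ᵥ V.rv i = V.chart d K 0 ⬝ᵥ V.rv i +
      ∑ a, (Δ.projN K (V.v i) a : ℝ) * t a := by
  simp only [chart, Pi.zero_apply, zero_smul, Finset.sum_const_zero, add_zero, add_dotProduct]
  congr 1
  rw [sum_dotProduct]
  refine Finset.sum_congr rfl fun a _ => ?_
  rw [smul_dotProduct, rv, toReal_dotProduct, smul_eq_mul, mul_comm]
  rfl

variable [DecidableEq ι]

lemma chart_dotProduct_rv_of_mem (V : Δ.EdgeVectors) (d : ι → ℝ) {K : Finset ι}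
    (hK : K ∈ Δ.simplices) (t : Fin (Δ.rankM K) → ℝ) {i : ι} (hi : i ∈ K) :
    V.chart d K t ⬝ᵥ V.rv i = d i := by
  -- The base point chosen by `Classical.epsilon` lies in A_K^* only because this set is nonempty; a
  -- vertex u_I with I ⊇ K belongs to it.
  have hne : ∃ u, u ∈ V.affineA d K := by
    obtain ⟨I, hI, hKI, hcard⟩ := Δ.pure K hK
    exact ⟨V.vertex d I, fun j hj => V.vertex_dotProduct_rv d ⟨I, hI, hcard⟩ (hKI hj)⟩
  have h0 : V.chart d K 0 = Classical.epsilon (· ∈ V.affineA d K) := by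
    simp [chart]
  rw [chart_dotProduct_rv, (projN_eq_zero_iff K _).2 (V.v_mem_latticeN hK hi), h0]
  have hspec : Classical.epsilon (· ∈ V.affineA d K) ⬝ᵥ V.rv i = d i :=
    Classical.epsilon_spec hne i hi
  simpa using hspec

lemma dotProduct_eq_vertex_add (V : Δ.EdgeVectors) {d : ι → ℝ} (I : Δ.Facet) {K : Finset ι}
    (hI : K ⊆ I.1) {u : Fin n → ℝ} (hu : ∀ i ∈ K, u ⬝ᵥ V.rv i = d i) (a : Fin n → ℝ) :
    u ⬝ᵥ a = V.vertex d I.1 ⬝ᵥ a +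
      ∑ i ∈ I.1 \ K, (u ⬝ᵥ V.rv i - d i) * (V.dualVec I.1 i ⬝ᵥ a) := by
  rw [V.dotProduct_eq_sum I, V.vertex_dotProduct, ← Finset.sum_sdiff hI,
    ← Finset.sum_sdiff hI (f := fun i => d i * _),
    Finset.sum_congr rfl fun i (hi : i ∈ K) => by rw [hu i hi]]
  simp only [sub_mul, Finset.sum_sub_distrib]
  ring

/-- The matrix of the linear parts of the defining inequalities of the cone at `u_I`. -/
def signedPairing (V : Δ.EdgeVectors) (v : Fin n → ℝ) (I : Δ.Facet) {K : Finset ι}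
    (hI : K ⊆ I.1) : Matrix (Fin (Δ.rankM K)) (Fin (Δ.rankM K)) ℝ :=
  Matrix.diagonal (fun b => Real.sign (V.dualVec I.1 (V.enumSdiff I hI b) ⬝ᵥ v)) *
    (V.pairing I hI).map (Int.cast : ℤ → ℝ)

lemma abs_det_signedPairing (V : Δ.EdgeVectors) {v : Fin n → ℝ} {K : Finset ι}
    (hv : V.IsGeneric K v) (I : Δ.Facet) (hI : K ⊆ I.1) :
    |(V.signedPairing v I hI).det| = ((V.pairing I hI).det.natAbs : ℝ) := by
  rw [signedPairing, Matrix.det_mul, Matrix.det_diagonal, abs_mul, Finset.abs_prod,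
    Finset.prod_eq_one, one_mul]
  · rw [show (V.pairing I hI).map (Int.cast : ℤ → ℝ) =
      (Int.castRingHom ℝ).mapMatrix (V.pairing I hI) from rfl, ← RingHom.map_det, eq_intCast,
      Nat.cast_natAbs, Int.cast_abs]
  · intro b _
    rcases Real.sign_apply_eq_of_ne_zero _ (hv I hI _ (V.enumSdiff I hI b).2) with h | h <;>
      rw [h] <;> norm_num

lemma signedPairing_mulVec (V : Δ.EdgeVectors) (d : ι → ℝ) (v : Fin n → ℝ) (I : Δ.Facet)
    {K : Finset ι} (hI : K ⊆ I.1) (t : Fin (Δ.rankM K) → ℝ) (b : Fin (Δ.rankM K)) :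
    (V.signedPairing v I hI *ᵥ t) b =
      Real.sign (V.dualVec I.1 (V.enumSdiff I hI b) ⬝ᵥ v) *
        (V.chart d K t ⬝ᵥ V.rv (V.enumSdiff I hI b) -
          V.chart d K 0 ⬝ᵥ V.rv (V.enumSdiff I hI b)) := by
  rw [V.chart_dotProduct_rv d K t, add_sub_cancel_left, signedPairing, ← Matrix.mulVec_mulVec,
    Matrix.mulVec_diagonal]
  rfl

lemma det_signedPairing_ne_zero (V : Δ.EdgeVectors) {v : Fin n → ℝ} {K : Finset ι}
    (hv : V.IsGeneric K v) (I : Δ.Facet) (hI : K ⊆ I.1) : (V.signedPairing v I hI).det ≠ 0 := by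
  rw [← abs_ne_zero, V.abs_det_signedPairing hv I hI]
  exact_mod_cast Int.natAbs_ne_zero.2 (V.det_pairing_ne_zero I hI)

open Classical in
/-- The Laplace transform of the term of `DH` belonging to `I`. -/
lemma laplace_dualCone (V : Δ.EdgeVectors) (d : ι → ℝ) {v : Fin n → ℝ} {K : Finset ι}
    (hv : V.IsGeneric K v) (I : Δ.Facet) (hI : K ⊆ I.1) {a : Fin n → ℝ}
    (ha : ∀ i ∈ I.1 \ K, Real.sign (V.dualVec I.1 i ⬝ᵥ v) * (V.dualVec I.1 i ⬝ᵥ a) < 0)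
    {s : ℝ} (hs : 0 < s) :
    Integrable (fun t => Real.exp (s * (V.chart d K t ⬝ᵥ a)) *
      if V.chart d K t ∈ V.dualCone d v K I.1 then
        (V.sign v K I.1 : ℝ) * (Δ.w I.1 : ℝ) else 0) ∧
    s ^ Δ.rankM K * ∫ t, Real.exp (s * (V.chart d K t ⬝ᵥ a)) *
      (if V.chart d K t ∈ V.dualCone d v K I.1 then
        (V.sign v K I.1 : ℝ) * (Δ.w I.1 : ℝ) else 0) =
      (Δ.w I.1 : ℝ) / ((V.pairing I hI).det.natAbs * ∏ i ∈ I.1 \ K, V.dualVec I.1 i ⬝ᵥ a) *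
        Real.exp (s * (V.vertex d I.1 ⬝ᵥ a)) := by
  have hK := Δ.down_closed _ I.2.1 _ hI
  set e := V.enumSdiff I hI with he
  set σ : ι → ℝ := fun i => Real.sign (V.dualVec I.1 i ⬝ᵥ v) with hσ
  have hσσ : ∀ i ∈ I.1 \ K, σ i * σ i = 1 := fun i hi => real_sign_mul_self (hv I hI i hi)
  set M := V.signedPairing v I hI with hM
  -- β is chosen so that (M t + β)_b is the coordinate of u - u_I along (u_i^I)⁺, i = e b; then k b
  -- = s⟨(u_i^I)⁺,a⟩ is the rate of decay along this edge.
  set β : Fin (Δ.rankM K) → ℝ := fun b => σ (e b) * (V.chart d K 0 ⬝ᵥ V.rv (e b) - d (e b))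
    with hβ
  set k : Fin (Δ.rankM K) → ℝ := fun b => s * (σ (e b) * (V.dualVec I.1 (e b) ⬝ᵥ a)) with hk
  have hkneg : ∀ b, k b < 0 := fun b => mul_neg_of_pos_of_neg hs (ha _ (e b).2)
  have hMβ : ∀ t b, (M *ᵥ t) b + β b = σ (e b) * (V.chart d K t ⬝ᵥ V.rv (e b) - d (e b)) := by
    intro t b
    rw [hM, V.signedPairing_mulVec d v I hI]
    simp only [hβ, hσ, ← he]
    ring
  have hsum : ∀ f : ι → ℝ, ∑ i ∈ I.1 \ K, f i = ∑ b, f (e b) := by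
    intro f
    rw [← Finset.sum_coe_sort, ← e.sum_comp]
  have hprod : ∀ f : ι → ℝ, ∏ i ∈ I.1 \ K, f i = ∏ b, f (e b) := by
    intro f
    rw [← Finset.prod_coe_sort, ← e.prod_comp]
  obtain ⟨hint, hval⟩ := integral_exp_simplicialCone (V.det_signedPairing_ne_zero hv I hI) β k hkneg
  have hfun : (fun t => Real.exp (s * (V.chart d K t ⬝ᵥ a)) *
      if V.chart d K t ∈ V.dualCone d v K I.1 then
        (V.sign v K I.1 : ℝ) * (Δ.w I.1 : ℝ) else 0) =
      fun t => (Real.exp (s * (V.vertex d I.1 ⬝ᵥ a)) * ((V.sign v K I.1 : ℝ) * (Δ.w I.1 : ℝ))) *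
        {t | ∀ b, 0 ≤ (M *ᵥ t) b + β b}.indicator
          (fun t => Real.exp (∑ b, k b * ((M *ᵥ t) b + β b))) t := by
    funext t
    have htK : ∀ i ∈ K, V.chart d K t ⬝ᵥ V.rv i = d i :=
      fun i hi => V.chart_dotProduct_rv_of_mem d hK t hi
    have hmem : V.chart d K t ∈ V.dualCone d v K I.1 ↔ t ∈ {t | ∀ b, 0 ≤ (M *ᵥ t) b + β b} := by
      rw [V.mem_dualCone_iff d hv I hI, Set.mem_ofPred_eq]
      constructor
      · intro h b
        rw [hMβ]
        exact h.2 _ (e b).2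
      · intro h
        refine ⟨htK, fun i hi => ?_⟩
        have := h (e.symm ⟨i, hi⟩)
        rw [hMβ, Equiv.apply_symm_apply] at this
        exact this
    by_cases h : V.chart d K t ∈ V.dualCone d v K I.1
    · rw [if_pos h, Set.indicator_of_mem (hmem.1 h)]
      have hexp : s * (V.chart d K t ⬝ᵥ a) = s * (V.vertex d I.1 ⬝ᵥ a) +
          ∑ b, k b * ((M *ᵥ t) b + β b) := by
        rw [V.dotProduct_eq_vertex_add I hI htK a, mul_add, hsum, Finset.mul_sum]
        congr 1
        refine Finset.sum_congr rfl fun b _ => ?_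
        rw [hMβ]
        simp only [hk]
        linear_combination (-s * (V.dualVec I.1 (e b) ⬝ᵥ a) *
          (V.chart d K t ⬝ᵥ V.rv (e b) - d (e b))) * hσσ _ (e b).2
      rw [hexp, Real.exp_add]
      ring
    · rw [if_neg h, Set.indicator_of_notMem (fun h' => h (hmem.2 h')), mul_zero, mul_zero]
  rw [hfun]
  refine ⟨hint.const_mul _, ?_⟩
  rw [integral_const_mul, hval, V.abs_det_signedPairing hv I hI, V.sign_eq_prod hv I hI, hprod,
    hprod]
  have hterm : ∀ b, -(k b)⁻¹ = (-σ (e b)) * (s⁻¹ * (V.dualVec I.1 (e b) ⬝ᵥ a)⁻¹) := by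
    intro b
    have h1 : (σ (e b))⁻¹ = σ (e b) := Real.inv_sign _
    simp only [hk]
    rw [mul_inv, mul_inv, h1]
    ring
  -- The factor -σ of (-1)^I meets the factor -σ of -(k b)⁻¹, and σ² = 1 leaves ⟨u_i^I,a⟩ itself,
  -- independent of v.
  have hP : (∏ b, -σ (e b)) * ∏ b, -(k b)⁻¹ =
      (s ^ Δ.rankM K)⁻¹ * (∏ b, V.dualVec I.1 (e b) ⬝ᵥ a)⁻¹ := by
    rw [← Finset.prod_mul_distrib, ← Finset.prod_inv_distrib]
    have : (s ^ Δ.rankM K)⁻¹ = ∏ _b : Fin (Δ.rankM K), s⁻¹ := by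
      rw [Finset.prod_const, Finset.card_univ, Fintype.card_fin, inv_pow]
    rw [this, ← Finset.prod_mul_distrib]
    refine Finset.prod_congr rfl fun b _ => ?_
    rw [hterm]
    linear_combination (s⁻¹ * (V.dualVec I.1 (e b) ⬝ᵥ a)⁻¹) * hσσ _ (e b).2
  have hs0 : s ^ Δ.rankM K ≠ 0 := (pow_pos hs _).ne'
  calc s ^ Δ.rankM K * (Real.exp (s * (V.vertex d I.1 ⬝ᵥ a)) *
        ((∏ b, -σ (e b)) * (Δ.w I.1 : ℝ)) *
        (((V.pairing I hI).det.natAbs : ℝ)⁻¹ * ∏ b, -(k b)⁻¹))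
      = s ^ Δ.rankM K * Real.exp (s * (V.vertex d I.1 ⬝ᵥ a)) * (Δ.w I.1 : ℝ) *
        ((V.pairing I hI).det.natAbs : ℝ)⁻¹ * ((∏ b, -σ (e b)) * ∏ b, -(k b)⁻¹) := by ring
    _ = _ := by
      rw [hP, div_eq_mul_inv, mul_inv]
      field_simp

/-- The open set of directions in which the exponential decays on all the cones. -/
def decayDirections (V : Δ.EdgeVectors) (K : Finset ι) (v : Fin n → ℝ) : Set (Fin n → ℝ) :=
  {a | ∀ I : Δ.Facet, K ⊆ I.1 → ∀ i ∈ I.1 \ K,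
    Real.sign (V.dualVec I.1 i ⬝ᵥ v) * (V.dualVec I.1 i ⬝ᵥ a) < 0}

lemma neg_mem_decayDirections (V : Δ.EdgeVectors) {K : Finset ι} {v : Fin n → ℝ}
    (hv : V.IsGeneric K v) : -v ∈ V.decayDirections K v := by
  intro I hI i hi
  rw [dotProduct_neg, mul_neg, neg_lt_zero]
  exact Real.sign_mul_pos_of_ne_zero _ (hv I hI i hi)

variable [Fintype ι]

lemma measurable_DH (V : Δ.EdgeVectors) (d : ι → ℝ) {v : Fin n → ℝ} {K : Finset ι}
    (hv : V.IsGeneric K v) : Measurable (V.DH d v K) := by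
  classical
  unfold DH
  refine Finset.measurable_sum _ fun I _ => ?_
  by_cases hI : K ⊆ I.1
  · refine Measurable.ite ?_ measurable_const measurable_const
    have : {u | K ⊆ I.1 ∧ u ∈ V.dualCone d v K I.1} =
        {u | (∀ i ∈ K, u ⬝ᵥ V.rv i = d i) ∧
          ∀ i ∈ I.1 \ K, 0 ≤ Real.sign (V.dualVec I.1 i ⬝ᵥ v) * (u ⬝ᵥ V.rv i - d i)} := by
      ext u
      rw [Set.mem_ofPred_eq, Set.mem_ofPred_eq, V.mem_dualCone_iff d hv I hI]
      exact and_iff_right hI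
    rw [this]
    apply IsClosed.measurableSet
    simp only [Set.ofPred_and, Set.ofPred_forall]
    refine IsClosed.inter ?_ ?_
    · exact isClosed_iInter fun i => isClosed_iInter fun _ =>
        isClosed_eq (by fun_prop) continuous_const
    · exact isClosed_iInter fun i => isClosed_iInter fun _ =>
        isClosed_le continuous_const (by fun_prop)
  · simp [hI]

/-- Almost all points of `A_K^*` lie on no facet hyperplane. -/
lemma ae_chart_generic (V : Δ.EdgeVectors) (d : ι → ℝ) {v : Fin n → ℝ} {K : Finset ι}
    (hv : V.IsGeneric K v) :
    ∀ᵐ t : Fin (Δ.rankM K) → ℝ, ∀ I : Δ.Facet, K ⊆ I.1 → ∀ i ∈ I.1 \ K,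
      V.chart d K t ⬝ᵥ V.rv i ≠ d i := by
  rw [ae_all_iff]
  intro I
  by_cases hI : K ⊆ I.1
  · have h : ∀ᵐ t : Fin (Δ.rankM K) → ℝ, ∀ b : Fin (Δ.rankM K),
        V.chart d K t ⬝ᵥ V.rv (V.enumSdiff I hI b) ≠ d (V.enumSdiff I hI b) := by
      rw [ae_all_iff]
      intro b
      filter_upwards [ae_mulVec_ne (V.det_signedPairing_ne_zero hv I hI) b
        (Real.sign (V.dualVec I.1 (V.enumSdiff I hI b) ⬝ᵥ v) *
          (d (V.enumSdiff I hI b) - V.chart d K 0 ⬝ᵥ V.rv (V.enumSdiff I hI b)))] with t ht h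
      rw [V.signedPairing_mulVec d, h] at ht
      exact ht rfl
    filter_upwards [h] with t ht _ i hi
    have := ht ((V.enumSdiff I hI).symm ⟨i, hi⟩)
    rwa [Equiv.apply_symm_apply] at this
  · exact Eventually.of_forall fun t h => absurd h hI

/-- The support of the Duistermaat–Heckman function is bounded, up to a null set. -/
lemma ae_DH_bounded (hΔ : Δ.IsComplete) (V : Δ.EdgeVectors) (d : ι → ℝ) {v : Fin n → ℝ}
    {K : Finset ι} (hK : K ∈ Δ.simplices) (hv : V.IsGeneric K v) :
    ∃ B : ℝ, 0 ≤ B ∧ ∀ᵐ t : Fin (Δ.rankM K) → ℝ, V.DH d v K (V.chart d K t) ≠ 0 →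
      ∀ x, |V.chart d K t x| ≤ B := by
  -- Where `DH` is nonzero at a generic u, ⟨u,u⟩ ≤ ⟨u_I,u⟩ for some I, hence |u|² ≤ |u_I|², which
  -- this sum bounds uniformly in I.
  set B₀ : ℝ := ∑ I : Δ.Facet, V.vertex d I.1 ⬝ᵥ V.vertex d I.1 with hB₀
  have hnn : ∀ u : Fin n → ℝ, 0 ≤ u ⬝ᵥ u := fun u =>
    Finset.sum_nonneg fun x _ => mul_self_nonneg (u x)
  have hB₀0 : 0 ≤ B₀ := Finset.sum_nonneg fun I _ => hnn _
  refine ⟨Real.sqrt B₀, Real.sqrt_nonneg _, ?_⟩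
  filter_upwards [V.ae_chart_generic d hv] with t ht h0 x
  set u := V.chart d K t
  have hex : ∃ I : Δ.Facet, u ⬝ᵥ u ≤ V.vertex d I.1 ⬝ᵥ u := by
    by_contra! hall
    exact h0 (DH_eq_zero hΔ V d hv (fun i hi => V.chart_dotProduct_rv_of_mem d hK t hi) ht
      fun I _ => hall I)
  obtain ⟨I, hI⟩ := hex
  have h1 : V.vertex d I.1 ⬝ᵥ V.vertex d I.1 ≤ B₀ :=
    Finset.single_le_sum (f := fun I : Δ.Facet => V.vertex d I.1 ⬝ᵥ V.vertex d I.1)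
      (fun I _ => hnn _) (Finset.mem_univ I)
  have h2 := hnn (V.vertex d I.1 - u)
  simp only [sub_dotProduct, dotProduct_sub] at h2
  rw [dotProduct_comm u (V.vertex d I.1)] at h2
  have h3 : u ⬝ᵥ u ≤ B₀ := by linarith
  have h4 : u x * u x ≤ u ⬝ᵥ u :=
    Finset.single_le_sum (f := fun x => u x * u x) (fun x _ => mul_self_nonneg _)
      (Finset.mem_univ x)
  apply Real.abs_le_sqrt
  rw [sq]
  exact h4.trans h3

lemma isOpen_decayDirections (V : Δ.EdgeVectors) (K : Finset ι) (v : Fin n → ℝ) :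
    IsOpen (V.decayDirections K v) := by
  simp only [decayDirections, Set.ofPred_forall]
  exact isOpen_iInter_of_finite fun I => isOpen_iInter_of_finite fun _ =>
    isOpen_iInter_of_finite fun i => isOpen_iInter_of_finite fun _ =>
      isOpen_lt (by fun_prop) continuous_const

/-- The cones are summed one by one. Multiplying numerator and denominator by |H_K| turns each
determinant into |H_I|, so the right side is |H_K| times the localization sum of e^{sξ} x_K
evaluated at a. -/
lemma laplace_DH (V : Δ.EdgeVectors) (d : ι → ℝ) {v : Fin n → ℝ} {K : Finset ι}
    (hK : K ∈ Δ.simplices) (hv : V.IsGeneric K v) {a : Fin n → ℝ}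
    (ha : a ∈ V.decayDirections K v) {s : ℝ} (hs : 0 < s) :
    Integrable (fun t => Real.exp (s * (V.chart d K t ⬝ᵥ a)) * V.DH d v K (V.chart d K t)) ∧
    s ^ Δ.rankM K * ∫ t, Real.exp (s * (V.chart d K t ⬝ᵥ a)) * V.DH d v K (V.chart d K t) =
      ∑ I : Δ.Facet with K ⊆ I.1, (Nat.card (V.H K) * (Δ.w I.1 : ℝ)) /
        (Nat.card (V.H I.1) * ∏ i ∈ I.1 \ K, V.dualVec I.1 i ⬝ᵥ a) *
          Real.exp (s * (V.vertex d I.1 ⬝ᵥ a)) := by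
  classical
  have hfun : (fun t => Real.exp (s * (V.chart d K t ⬝ᵥ a)) * V.DH d v K (V.chart d K t)) =
      fun t => ∑ I : Δ.Facet with K ⊆ I.1, Real.exp (s * (V.chart d K t ⬝ᵥ a)) *
        if V.chart d K t ∈ V.dualCone d v K I.1 then
          (V.sign v K I.1 : ℝ) * (Δ.w I.1 : ℝ) else 0 := by
    funext t
    rw [DH, ← Finset.mul_sum, Finset.sum_filter]
    congr 1
    refine Finset.sum_congr rfl fun I _ => ?_
    by_cases hI : K ⊆ I.1 <;> simp [hI]
  rw [hfun]
  have hterm := fun (I : Δ.Facet) (hI : K ⊆ I.1) =>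
    V.laplace_dualCone d hv I hI (ha I hI) hs
  constructor
  · exact integrable_finsetSum _ fun I hI => (hterm I (Finset.mem_filter.1 hI).2).1
  · rw [integral_finsetSum _ fun I hI => (hterm I (Finset.mem_filter.1 hI).2).1, Finset.mul_sum]
    refine Finset.sum_congr rfl fun I hI => ?_
    have hI' := (Finset.mem_filter.1 hI).2
    rw [(hterm I hI').2, V.natCard_H_facet_eq_mul I hI', Nat.cast_mul, mul_assoc,
      mul_div_mul_left _ _ (Nat.cast_ne_zero.2 (V.natCard_H_ne_zero hK))]

/-- `DH` is integrable on `A_K^*`, in the coordinates given by `chart`. -/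
lemma integrable_DH_chart (hΔ : Δ.IsComplete) (V : Δ.EdgeVectors) (d : ι → ℝ) {v : Fin n → ℝ}
    {K : Finset ι} (hK : K ∈ Δ.simplices) (hv : V.IsGeneric K v) :
    Integrable (fun t => V.DH d v K (V.chart d K t)) := by
  obtain ⟨B, hB0, hB⟩ := ae_DH_bounded hΔ V d hK hv
  -- The single cones need not have finite volume, but e^{-⟨u,v⟩} `DH` is integrable, and the weight
  -- is bounded below on the bounded support, so it can be divided out.
  have h := (V.laplace_DH d hK hv (V.neg_mem_decayDirections hv) one_pos).1
  refine (h.norm.const_mul (Real.exp (∑ x, B * |v x|))).mono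
    ((V.measurable_DH d hv).comp (V.chart_continuous d K).measurable).aestronglyMeasurable ?_
  filter_upwards [hB] with t ht
  by_cases h0 : V.DH d v K (V.chart d K t) = 0
  · rw [h0, norm_zero]; exact norm_nonneg _
  · have hb : V.chart d K t ⬝ᵥ v ≤ ∑ x, B * |v x| := by
      refine Finset.sum_le_sum fun x _ => (le_abs_self _).trans ?_
      rw [abs_mul]
      exact mul_le_mul_of_nonneg_right (ht h0 x) (abs_nonneg _)
    rw [norm_mul, norm_norm, norm_mul, Real.norm_of_nonneg (Real.exp_nonneg _),
      Real.norm_of_nonneg (Real.exp_nonneg _), ← mul_assoc, ← Real.exp_add, one_mul,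
      dotProduct_neg]
    exact le_mul_of_one_le_left (norm_nonneg _) (Real.one_le_exp (by linarith))

/-- The localization formula for the moments of `DH`. -/
lemma moment_formula (hΔ : Δ.IsComplete) (V : Δ.EdgeVectors) (d : ι → ℝ) {v : Fin n → ℝ}
    {K : Finset ι} (hK : K ∈ Δ.simplices) (hv : V.IsGeneric K v) {a : Fin n → ℝ}
    (ha : a ∈ V.decayDirections K v) (m : ℕ) :
    ∑ I : Δ.Facet with K ⊆ I.1, (Nat.card (V.H K) * (Δ.w I.1 : ℝ)) /
        (Nat.card (V.H I.1) * ∏ i ∈ I.1 \ K, V.dualVec I.1 i ⬝ᵥ a) *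
          ((V.vertex d I.1 ⬝ᵥ a) ^ m / m.factorial) =
      if m < Δ.rankM K then 0 else ((m - Δ.rankM K).factorial : ℝ)⁻¹ *
        ∫ t, (V.chart d K t ⬝ᵥ a) ^ (m - Δ.rankM K) * V.DH d v K (V.chart d K t) := by
  obtain ⟨B, hB0, hB⟩ := ae_DH_bounded hΔ V d hK hv
  refine exp_sum_coeff (R := ∑ x, B * |a x|) ?_ (integrable_DH_chart hΔ V d hK hv) ?_ _ _ _ _
    (fun s hs => (V.laplace_DH d hK hv ha hs).2) m
  · have := V.chart_continuous d K
    exact (Continuous.aestronglyMeasurable (by fun_prop))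
  · filter_upwards [hB] with t ht h0
    refine (Finset.abs_sum_le_sum_abs _ _).trans (Finset.sum_le_sum fun x _ => ?_)
    rw [abs_mul]
    exact mul_le_mul_of_nonneg_right (ht h0 x) (abs_nonneg _)

/-- The moments of `DH` are polynomials. -/
lemma integral_pow_mul_DH (hΔ : Δ.IsComplete) (V : Δ.EdgeVectors) (d : ι → ℝ) {v : Fin n → ℝ}
    {K : Finset ι} (hK : K ∈ Δ.simplices) (hv : V.IsGeneric K v) (j : ℕ) (a : Fin n → ℝ) :
    ∫ t, (V.chart d K t ⬝ᵥ a) ^ j * V.DH d v K (V.chart d K t) =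
      ∑ p : Fin j → Fin n, (∫ t, (∏ l, V.chart d K t (p l)) * V.DH d v K (V.chart d K t)) *
        ∏ l, a (p l) := by
  obtain ⟨B, hB0, hB⟩ := ae_DH_bounded hΔ V d hK hv
  have hfun : ∀ t, (V.chart d K t ⬝ᵥ a) ^ j * V.DH d v K (V.chart d K t) =
      ∑ p : Fin j → Fin n, ((∏ l, V.chart d K t (p l)) * V.DH d v K (V.chart d K t)) *
        ∏ l, a (p l) := by
    intro t
    rw [dotProduct, Fintype.sum_pow, Finset.sum_mul]
    refine Finset.sum_congr rfl fun p _ => ?_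
    rw [Finset.prod_mul_distrib]
    ring
  simp_rw [hfun]
  rw [integral_finsetSum]
  · exact Finset.sum_congr rfl fun p _ => integral_mul_const _ _
  · intro p _
    refine Integrable.mul_const (integrable_bdd_mul_of_support (R := B ^ j) ?_
      (integrable_DH_chart hΔ V d hK hv) ?_) _
    · have := V.chart_continuous d K
      exact Continuous.aestronglyMeasurable (by fun_prop)
    · filter_upwards [hB] with t ht h0
      rw [Finset.abs_prod]
      refine (Finset.prod_le_prod (fun _ _ => abs_nonneg _) fun l _ => ht h0 (p l)).trans ?_
      simp

end SimplicialMultiFan.EdgeVectors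

end MultiFan
end

/-! ### From moments to the push-forward. -/

noncomputable section

namespace MultiFan

open MeasureTheory

section Fractions

lemma sum_div_mul_prod {F κ : Type*} [Field F] [DecidableEq κ] (S : Finset κ) (p q : κ → F)
    (hq : ∀ x ∈ S, q x ≠ 0) :
    (∑ x ∈ S, p x / q x) * ∏ x ∈ S, q x = ∑ x ∈ S, p x * ∏ y ∈ S.erase x, q y := by
  rw [Finset.sum_mul]
  refine Finset.sum_congr rfl fun x hx => ?_
  rw [← Finset.mul_prod_erase S q hx]
  have := hq x hx
  field_simp

/-- A polynomial which vanishes on a nonempty open set is zero. -/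
lemma mvPolynomial_eq_zero_of_open {n : ℕ} {P : MvPolynomial (Fin n) ℝ} {O : Set (Fin n → ℝ)}
    (hO : IsOpen O) (hne : O.Nonempty) (h : ∀ a ∈ O, MvPolynomial.eval a P = 0) : P = 0 := by
  obtain ⟨x, hx⟩ := hne
  obtain ⟨ε, hε, hball⟩ := Metric.isOpen_iff.1 hO x hx
  refine MvPolynomial.funext_set (fun i => Metric.ball (x i) ε) (fun i => ?_) fun a ha => ?_
  · exact infinite_of_mem_nhds (x i) (Metric.ball_mem_nhds _ hε)
  · rw [map_zero]
    refine h a (hball ?_)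
    rw [ball_pi x hε]
    exact ha

/-- A sum of fractions of polynomials whose values agree with those of a polynomial `Q` on a
nonempty open set, away from the poles, is equal to `Q`. -/
lemma sum_div_eq_algebraMap {n : ℕ} {κ : Type*} (S : Finset κ)
    (p q : κ → MvPolynomial (Fin n) ℝ) (hq : ∀ x ∈ S, q x ≠ 0) (Q : MvPolynomial (Fin n) ℝ)
    {O : Set (Fin n → ℝ)} (hO : IsOpen O) (hne : O.Nonempty)
    (h : ∀ a ∈ O, (∀ x ∈ S, MvPolynomial.eval a (q x) ≠ 0) →
      ∑ x ∈ S, MvPolynomial.eval a (p x) / MvPolynomial.eval a (q x) = MvPolynomial.eval a Q) :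
    ∑ x ∈ S, algebraMap _ (FractionRing (MvPolynomial (Fin n) ℝ)) (p x) /
      algebraMap _ (FractionRing (MvPolynomial (Fin n) ℝ)) (q x) = algebraMap _ _ Q := by
  classical
  have hinj := IsFractionRing.injective (MvPolynomial (Fin n) ℝ)
    (FractionRing (MvPolynomial (Fin n) ℝ))
  have hD : ∏ x ∈ S, q x ≠ 0 := Finset.prod_ne_zero_iff.2 hq
  have hP : ∑ x ∈ S, p x * ∏ y ∈ S.erase x, q y = Q * ∏ x ∈ S, q x := by
    rw [← sub_eq_zero]
    -- The extra factor ∏ q makes the product vanish at the poles too, hence on all of O.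
    refine (mul_eq_zero.1 (mvPolynomial_eq_zero_of_open (P := (∑ x ∈ S, p x *
      ∏ y ∈ S.erase x, q y - Q * ∏ x ∈ S, q x) * ∏ x ∈ S, q x) hO hne fun a ha => ?_)).resolve_right
      hD
    by_cases hz : ∀ x ∈ S, MvPolynomial.eval a (q x) ≠ 0
    · have := sum_div_mul_prod S (fun x => MvPolynomial.eval a (p x))
        (fun x => MvPolynomial.eval a (q x)) hz
      rw [h a ha hz] at this
      simp only [map_mul, map_sub, map_sum, map_prod]
      rw [this, sub_self, zero_mul]
    · push Not at hz
      obtain ⟨x, hx, hx0⟩ := hz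
      rw [map_mul, map_prod (MvPolynomial.eval a) q S, Finset.prod_eq_zero (f := fun x => MvPolynomial.eval a (q x)) hx hx0,
        mul_zero]
  have hq' : ∀ x ∈ S, algebraMap _ (FractionRing (MvPolynomial (Fin n) ℝ)) (q x) ≠ 0 :=
    fun x hx h0 => hq x hx (hinj (by rw [h0, map_zero]))
  refine mul_right_cancel₀ (b := ∏ x ∈ S, algebraMap _ (FractionRing (MvPolynomial (Fin n) ℝ)) (q x))
    (Finset.prod_ne_zero_iff.2 hq') ?_
  rw [sum_div_mul_prod S _ _ hq', ← map_prod, ← map_mul, ← hP, map_sum]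
  simp only [map_mul, map_prod]

end Fractions

lemma eval_linForm {n : ℕ} (u a : Fin n → ℝ) : MvPolynomial.eval a (linForm u) = u ⬝ᵥ a := by
  simp [linForm, dotProduct, MvPolynomial.smul_eval]

lemma linForm_ne_zero {n : ℕ} {u : Fin n → ℝ} (hu : u ≠ 0) : linForm u ≠ 0 := by
  intro h
  apply hu
  funext x
  have := eval_linForm u (Pi.single x 1)
  rw [h, map_zero, dotProduct_single_one] at this
  exact this.symm

namespace SimplicialMultiFan.EdgeVectors

variable {n : ℕ} {ι : Type*} [Fintype ι] [DecidableEq ι] {Δ : SimplicialMultiFan n ι}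

lemma restrict_x (V : Δ.EdgeVectors) (I : Δ.Facet) (i : ι) :
    V.restrict I (Δ.x i) = if i ∈ I.1 then linForm (V.dualVec I.1 i) else 0 := by
  change V.restrictPoly I.1 (MvPolynomial.X i) = _
  rw [restrictPoly, MvPolynomial.aeval_X]

lemma eval_restrict_xi (V : Δ.EdgeVectors) (d : ι → ℝ) (I : Δ.Facet) (a : Fin n → ℝ) :
    MvPolynomial.eval a (V.restrict I (Δ.xi d)) = V.vertex d I.1 ⬝ᵥ a := by
  rw [xi, map_sum, map_sum, vertex_dotProduct, ← Finset.sum_subset (Finset.subset_univ I.1)]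
  · refine Finset.sum_congr rfl fun i hi => ?_
    rw [map_smul, restrict_x, if_pos hi, MvPolynomial.smul_eval, eval_linForm]
  · intro i _ hi
    rw [map_smul, restrict_x, if_neg hi, smul_zero, map_zero]

lemma eval_restrict_xProd (V : Δ.EdgeVectors) (K : Finset ι) (I : Δ.Facet) (a : Fin n → ℝ) :
    MvPolynomial.eval a (V.restrict I (Δ.xProd K)) =
      if K ⊆ I.1 then ∏ i ∈ K, V.dualVec I.1 i ⬝ᵥ a else 0 := by
  rw [xProd, map_prod, map_prod]
  split_ifs with h
  · refine Finset.prod_congr rfl fun i hi => ?_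
    rw [restrict_x, if_pos (h hi), eval_linForm]
  · obtain ⟨i, hi, hiI⟩ := Finset.not_subset.1 h
    exact Finset.prod_eq_zero hi (by rw [restrict_x, if_neg hiI, map_zero])

/-- The polynomial `π_*((ξ^m / m!) x_K)`. -/
def momentPoly (V : Δ.EdgeVectors) (d : ι → ℝ) (K : Finset ι) (v : Fin n → ℝ) (m : ℕ) :
    PtCohomology n :=
  if m < Δ.rankM K then 0 else
    MvPolynomial.C ((Nat.card (V.H K) : ℝ)⁻¹ * ((m - Δ.rankM K).factorial : ℝ)⁻¹) *
    ∑ p : Fin (m - Δ.rankM K) → Fin n,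
      MvPolynomial.C (∫ t, (∏ l, V.chart d K t (p l)) * V.DH d v K (V.chart d K t)) *
        ∏ l, MvPolynomial.X (p l)

lemma eval_momentPoly (hΔ : Δ.IsComplete) (V : Δ.EdgeVectors) (d : ι → ℝ) {K : Finset ι}
    (hK : K ∈ Δ.simplices) {v : Fin n → ℝ} (hv : V.IsGeneric K v) (m : ℕ) (a : Fin n → ℝ) :
    MvPolynomial.eval a (V.momentPoly d K v m) = (Nat.card (V.H K) : ℝ)⁻¹ *
      if m < Δ.rankM K then 0 else ((m - Δ.rankM K).factorial : ℝ)⁻¹ *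
        ∫ t, (V.chart d K t ⬝ᵥ a) ^ (m - Δ.rankM K) * V.DH d v K (V.chart d K t) := by
  rw [momentPoly]
  split_ifs with h
  · simp
  · rw [integral_pow_mul_DH hΔ V d hK hv]
    simp [mul_assoc]

/-- For m ≥ r = `rankM` the polynomial is homogeneous of degree m - r, so only m = r leaves a
constant, the moment of order 0. -/
lemma constantCoeff_momentPoly (V : Δ.EdgeVectors) (d : ι → ℝ) (K : Finset ι) (v : Fin n → ℝ)
    (m : ℕ) : MvPolynomial.constantCoeff (V.momentPoly d K v m) =
      if m = Δ.rankM K then (Nat.card (V.H K) : ℝ)⁻¹ * ∫ t, V.DH d v K (V.chart d K t) else 0 := by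
  rw [momentPoly]
  rcases lt_trichotomy m (Δ.rankM K) with h | h | h
  · rw [if_pos h, if_neg h.ne, map_zero]
  · subst h
    rw [if_neg (lt_irrefl _), if_pos rfl]
    have h0 : Δ.rankM K - Δ.rankM K = 0 := Nat.sub_self _
    generalize Δ.rankM K - Δ.rankM K = j at h0
    subst h0
    simp
  · rw [if_neg h.not_gt, if_neg h.ne']
    have h0 : Nonempty (Fin (m - Δ.rankM K)) := ⟨⟨0, by omega⟩⟩
    rw [map_mul, map_sum, Finset.sum_eq_zero, mul_zero]
    intro p _
    rw [map_mul, map_prod, Finset.prod_eq_zero (Finset.mem_univ h0.some), mul_zero]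
    simp

/-- Both sides are compared at the directions of decay, a nonempty open set. There ι_I^*(x_K) is 0
unless K ⊆ I, and otherwise cancels the factors u_i^I, i ∈ K, of the denominator, which leaves the
sum in `moment_formula`. -/
lemma pushforward_eq (hΔ : Δ.IsComplete) (V : Δ.EdgeVectors) (d : ι → ℝ) {K : Finset ι}
    (hK : K ∈ Δ.simplices) {v : Fin n → ℝ} (hv : V.IsGeneric K v) (m : ℕ) :
    algebraMap _ (FractionRing (PtCohomology n)) (V.momentPoly d K v m) =
      V.pushforward (((m.factorial : ℝ)⁻¹ • Δ.xi d ^ m) * Δ.xProd K) := by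
  symm
  have hH : ∀ I : Δ.Facet, (Nat.card (V.H I.1) : ℝ) ≠ 0 := fun I =>
    Nat.cast_ne_zero.2 (V.natCard_H_facet_ne_zero I)
  have hHK : (Nat.card (V.H K) : ℝ) ≠ 0 := Nat.cast_ne_zero.2 (V.natCard_H_ne_zero hK)
  refine sum_div_eq_algebraMap Finset.univ _ _ (fun I _ => ?_) _
    (V.isOpen_decayDirections K v) ⟨-v, V.neg_mem_decayDirections hv⟩ fun a ha hne => ?_
  · refine mul_ne_zero ?_ (Finset.prod_ne_zero_iff.2 fun i hi =>
      linForm_ne_zero (V.dualVec_ne_zero I hi))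
    rw [Ne, MvPolynomial.C_eq_zero]
    exact hH I
  · rw [eval_momentPoly hΔ V d hK hv, ← moment_formula hΔ V d hK hv ha m, Finset.mul_sum,
      Finset.sum_filter]
    refine Finset.sum_congr rfl fun I _ => ?_
    have hden := hne I (Finset.mem_univ I)
    simp only [map_mul, map_smul, map_pow, map_prod, MvPolynomial.eval_C, MvPolynomial.smul_eval,
      eval_linForm, eval_restrict_xi, eval_restrict_xProd] at hden ⊢
    split_ifs with hI
    · rw [← Finset.prod_sdiff hI] at hden ⊢
      have h1 := left_ne_zero_of_mul (right_ne_zero_of_mul hden)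
      have h2 := right_ne_zero_of_mul (right_ne_zero_of_mul hden)
      have h3 := hH I
      have h4 : (m.factorial : ℝ) ≠ 0 := Nat.cast_ne_zero.2 m.factorial_ne_zero
      field_simp
    · simp

lemma pStar_eq (V : Δ.EdgeVectors) {y : Δ.Cohomology} {f : PtCohomology n}
    (hf : algebraMap _ (FractionRing (PtCohomology n)) f = V.pushforward y) :
    V.pStar y = MvPolynomial.constantCoeff f := by
  have h : V.PushforwardInPt y := ⟨f, hf⟩
  rw [pStar, dif_pos h]
  congr 1
  exact IsFractionRing.injective (PtCohomology n) (FractionRing (PtCohomology n))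
    (h.choose_spec.trans hf.symm)

end SimplicialMultiFan.EdgeVectors

end MultiFan
end

open MultiFan in
/-- `(1 / |H_{K,𝒱}|) vol P(ξ)_K = p_*(e^ξ x_K)`, where `p_*(e^ξ x_K) = ∑_m p_*((ξ^m / m!) x_K)`; the
objects in the formula are moreover well defined: the integral defining the volume converges,
`H_{K,𝒱}` is finite, and `π_*` maps every term of `e^ξ x_K` into `H_T^*(pt)_ℝ`. -/
theorem proposition4p4 {n : ℕ} {ι : Type*} [Fintype ι] [DecidableEq ι]
    (Δ : SimplicialMultiFan n ι) (hΔ : Δ.IsComplete) (V : Δ.EdgeVectors)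
    (d : ι → ℝ) (K : Finset ι) (hK : K ∈ Δ.simplices)
    (v : Fin n → ℝ) (hv : V.IsGeneric K v) :
    MeasureTheory.Integrable (V.DH d v K) (V.volumeElement d K) ∧
    Finite (V.H K) ∧
    (∀ m : ℕ, V.PushforwardInPt (((m.factorial : ℝ)⁻¹ • Δ.xi d ^ m) * Δ.xProd K)) ∧
    HasSum (fun m : ℕ => V.pStar (((m.factorial : ℝ)⁻¹ • Δ.xi d ^ m) * Δ.xProd K))
      (1 / (Nat.card (V.H K) : ℝ) * V.vol d v K) := by
  have hmeas := V.measurable_DH d hv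
  have hchart := (V.chart_continuous d K).measurable
  have hvol : V.vol d v K = ∫ t, V.DH d v K (V.chart d K t) :=
    MeasureTheory.integral_map hchart.aemeasurable hmeas.aestronglyMeasurable
  have hpush := SimplicialMultiFan.EdgeVectors.pushforward_eq hΔ V d hK hv
  refine ⟨?_, Nat.finite_of_card_ne_zero (V.natCard_H_ne_zero hK), fun m => ⟨_, hpush m⟩, ?_⟩
  · exact (MeasureTheory.integrable_map_measure hmeas.aestronglyMeasurable hchart.aemeasurable).2
      (SimplicialMultiFan.EdgeVectors.integrable_DH_chart hΔ V d hK hv)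
  -- Only the term m = `rankM` of the exponential series survives p_*, so convergence is immediate.
  · have hterm : ∀ m : ℕ, V.pStar (((m.factorial : ℝ)⁻¹ • Δ.xi d ^ m) * Δ.xProd K) =
        if m = Δ.rankM K then 1 / (Nat.card (V.H K) : ℝ) * V.vol d v K else 0 := by
      intro m
      rw [V.pStar_eq (hpush m), V.constantCoeff_momentPoly, hvol, one_div]
    simp_rw [hterm]
    exact hasSum_ite_eq _ _
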